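/- Let $a,b$ be nonzero complex numbers with $|a|,|b|<1$ that are multiplicatively independent ($a^ib^j=1$ with $i,j\in\mathbb Z$ only for $i=j=0$). For a function $w$ of one variable and $N\ge 0$ put $$\mathcal I_N[w]=\frac1{N!}\Big(\frac{1-ab}{(1-a)(1-b)}\Big)^N\oint_{|z_1|=\dots=|z_N|=1}\ \prod_{i=1}^N\frac{w(z_i)\,dz_i}{2\pi i}\ \prod_{i\ne j}\frac{(1-\frac{z_i}{z_j})(1-ab\frac{z_i}{z_j})}{(1-a\frac{z_i}{z_j})(1-b\frac{z_i}{z_j})}.$$ The Hall–Littlewood index of $U(N)$ is $\mathcal I_N=\mathcal I_N[1/z]$. The *contribution* of a point $p=(p_1,\dots,p_N)$ ("ordered pole-tuple") to such an integral is the integral of the same integrand over the product of circles $|z_i-p_i|=\varepsilon$, which does not depend on $\varepsilon$ for all sufficiently small $\varepsilon>0$; $p$ *contributes* if this number is nonzero. The directed graph of $p$ has vertices $1,\dots,N$, an $a$-arrow $m\to n$ when $p_n=a\,p_m$, a $b$-arrow $m\to n$ when $p_n=b\,p_m$, and an unlabelled arrow from a seed $u$ to $n$ when $p_n=u$. Young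 diagrams are drawn with the first box $(0,0)$ at the lower left; box $(r,c)$ is in row $r$ (counted upwards) and column $c$. **(1) Hall–Littlewood index.** Let $0<|u|<1$ and $N\ge0$. With the shifted factor $w(z)=1/(z-u)$, every $p\in\mathbb C^N$ has a well-defined contribution, invariant under permuting the entries of $p$. A tuple $p$ contributes if and only if it is shaped like a Young diagram $\lambda$ with $N$ boxes: there is a bijection from the vertices to the boxes of $\lambda$ such that the vertex at box $(r,c)$ has $p=u\,a^cb^r$, the arrow from $u$ points exactly to the first box, the $a$-arrows are exactly those from a box to its right-hand neighbour, and the $b$-arrows exactly those from a box to its upper neighbour. Contributing tuples up to reordering are thus in bijection with $N$-box Young diagrams. There are finitely many contributing tuples, the integrands are integrable on the unit torus, and $$\mathcal I_N=\mathcal I_N[1/(z-u)]=\sum_{p}\ \text{contribution of }p,$$ the sum being over all ordered contributing tuples. **(2) $U(k)$.** Let $k\ge1$, $N\ge 0$ and let $u_1,\dots,u_k$ satisfy $0<|u_l|<1$ and $u_l\ne u_{l'}a^ib^j$ for all $l\neq l'$ and $i,j\in\mathbb Z$. For $w(z)=\prod_l\frac1{z-u_l}$, every $p\in\mathbb C^N$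 has a well-defined, permutation-invariant contribution, which is nonzero exactly when $p$ is shaped in the same sense like a $k$-tuple $(\lambda_1,\dots,\lambda_k)$ of Young diagrams with $N$ boxes in total, the $l$-th one seeded by $u_l$ (box $(r,c)$ of $\lambda_l$ sits at $u_la^cb^r$, the arrow from $u_l$ points exactly to the first box of $\lambda_l$, and arrows join only neighbouring boxes of the same diagram). Contributing tuples up to reordering are in bijection with such $k$-tuples; they are finite in number, the integrand is integrable on the unit torus, and $\mathcal I_N[w]$ is the sum of the contributions of all ordered tuples. If moreover $|ab|<|u_l|$ for all $l$, the same holds for the K-theoretic $U(k)$ instanton integrand $$w(z)=\frac1{z\prod_{l}(1-\frac{u_l}{z})(1-ab\frac{z}{u_l})},$$ with pole-tuples $p$ restricted to the open unit polydisc $|p_i|<1$ enclosed by the contour. -/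

import Mathlib

open scoped Topology

noncomputable section

namespace HallLittlewood

/-- The factor of an ordered pair of integration variables, for single-letter index
`a + b - ab` (`P = {a, b}`, `Z = {ab}`):
`(1 - x/y) (1 - ab x/y) / ((1 - a x/y) (1 - b x/y))`. -/
def pairFactor (a b x y : ℂ) : ℂ :=
  (1 - x / y) * (1 - a * b * (x / y)) / ((1 - a * (x / y)) * (1 - b * (x / y)))

/-- The `N`-variable integrand
`(1/N!) ((1-ab)/((1-a)(1-b)))^N ∏_i w(z_i)/(2πi) ∏_{i ≠ j} pairFactor (z_i) (z_j)`,
where `w` is the factor attached to each single variable. -/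
def integrand (a b : ℂ) (w : ℂ → ℂ) (N : ℕ) (z : Fin N → ℂ) : ℂ :=
  1 / (N.factorial : ℂ) * ((1 - a * b) / ((1 - a) * (1 - b))) ^ N
    * (∏ i, w (z i) / (2 * (Real.pi : ℂ) * Complex.I))
    * ∏ q ∈ (Finset.univ : Finset (Fin N)).offDiag, pairFactor a b (z q.1) (z q.2)

/-- The contour integral of the integrand over `|z_1| = ⋯ = |z_N| = 1`. -/
def contourIntegral (a b : ℂ) (w : ℂ → ℂ) (N : ℕ) : ℂ :=
  ∯ z in T((0 : Fin N → ℂ), fun _ => (1 : ℝ)), integrand a b w N z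

/-- The `U(N)` Hall-Littlewood index: the contour integral with measure `dz_i / (2πi z_i)`. -/
def hallLittlewoodIndex (a b : ℂ) (N : ℕ) : ℂ :=
  contourIntegral a b (fun z => 1 / z) N

/-- `c` is the contribution of the ordered pole-tuple `p` to the contour integral of `f`: for every
sufficiently small `ε > 0`, `f` is integrable over the product of the circles
`C_i = {|z_i - p_i| = ε}` and its integral over that product is `c`. -/
def HasContribution {N : ℕ} (f : (Fin N → ℂ) → ℂ) (p : Fin N → ℂ) (c : ℂ) : Prop :=
  ∀ᶠ ε : ℝ in 𝓝[>] 0, TorusIntegrable f p (fun _ => ε) ∧ (∯ z in T(p, fun _ => ε), f z) = c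

/-- The directed graph of a pole-tuple `p` has an arrow labelled `x` from vertex `m` to vertex
`n`. -/
def Arrow {N : ℕ} (x : ℂ) (p : Fin N → ℂ) (m n : Fin N) : Prop := p n = x * p m

/-- The directed graph of a pole-tuple `p` has the unlabelled arrow from the seed `u` to vertex
`n`. -/
def SeedArrow {N : ℕ} (u : ℂ) (p : Fin N → ℂ) (n : Fin N) : Prop := p n = u

/-- The right-hand neighbour of the box in row `s.1`, column `s.2`. -/
def right (s : ℕ × ℕ) : ℕ × ℕ := (s.1, s.2 + 1)

/-- The upper neighbour of a box; diagrams are drawn with row `0` at the bottom. -/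
def up (s : ℕ × ℕ) : ℕ × ℕ := (s.1 + 1, s.2)

/-- The directed graph of `p` is the Young diagram `lam`: the vertices are the boxes, the box in
row `r`, column `c` sits at `u a^c b^r`, the seed arrow points to the first box, `a`-arrows point
exactly to right-hand neighbours and `b`-arrows exactly to upper neighbours. -/
def HasYoungShape {N : ℕ} (a b u : ℂ) (lam : YoungDiagram) (p : Fin N → ℂ) : Prop :=
  ∃ e : Fin N ≃ lam.cells,
    (∀ n, p n = u * a ^ (e n).1.2 * b ^ (e n).1.1) ∧
    (∀ n, SeedArrow u p n ↔ (e n).1 = (0, 0)) ∧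
    (∀ m n, Arrow a p m n ↔ (e n).1 = right (e m).1) ∧
    (∀ m n, Arrow b p m n ↔ (e n).1 = up (e m).1)

/-- The same for a `k`-tuple of Young diagrams, the `l`-th one seeded by `u l`. -/
def HasMultiYoungShape {k N : ℕ} (a b : ℂ) (u : Fin k → ℂ) (lam : Fin k → YoungDiagram)
    (p : Fin N → ℂ) : Prop :=
  ∃ e : Fin N ≃ (Σ l : Fin k, (lam l).cells),
    (∀ n, p n = u (e n).1 * a ^ (e n).2.1.2 * b ^ (e n).2.1.1) ∧
    (∀ l n, SeedArrow (u l) p n ↔ (e n).1 = l ∧ (e n).2.1 = (0, 0)) ∧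
    (∀ m n, Arrow a p m n ↔ (e n).1 = (e m).1 ∧ (e n).2.1 = right (e m).2.1) ∧
    (∀ m n, Arrow b p m n ↔ (e n).1 = (e m).1 ∧ (e n).2.1 = up (e m).2.1)

/-- The one-variable factor with `k` seeds: `1 / ∏_l (z - u_l)`. -/
def seedFactor {k : ℕ} (u : Fin k → ℂ) (z : ℂ) : ℂ := 1 / ∏ l, (z - u l)

/-- The one-variable factor of the K-theoretic `U(k)` instanton integrand,
`1 / (z ∏_l (1 - u_l / z) (1 - ab z / u_l))`. -/
def instantonFactor {k : ℕ} (a b : ℂ) (u : Fin k → ℂ) (z : ℂ) : ℂ :=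
  1 / (z * ∏ l, ((1 - u l / z) * (1 - a * b * (z / u l))))

/-- The pole-tuples with all entries in `D` of the contour integral with one-variable factor `w`
are classified by the `k`-tuples of Young diagrams with `N` boxes in total, seeded by
`u_1, …, u_k`: every such tuple has a well-defined contribution, which is invariant under
reordering; it is nonzero exactly for the tuples shaped like a `k`-tuple of diagrams; every
`k`-tuple of diagrams occurs, for a pole-tuple that is unique up to reordering and that determines
it; and the contour integral is the (finite) sum of the contributions of all ordered pole-tuples
with entries in `D`. -/
def PolesClassified {k : ℕ} (a b : ℂ) (u : Fin k → ℂ) (w : ℂ → ℂ) (D : Set ℂ) (N : ℕ) : Prop :=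
  ∃ res : (Fin N → ℂ) → ℂ,
    (∀ p : Fin N → ℂ, (∀ i, p i ∈ D) → HasContribution (integrand a b w N) p (res p)) ∧
    (∀ p : Fin N → ℂ, (∀ i, p i ∈ D) → ∀ σ : Equiv.Perm (Fin N), res (p ∘ σ) = res p) ∧
    (∀ p : Fin N → ℂ, (∀ i, p i ∈ D) → (res p ≠ 0 ↔
      ∃ lam : Fin k → YoungDiagram,
        ∑ l, (lam l).card = N ∧ HasMultiYoungShape a b u lam p)) ∧
    (∀ lam : Fin k → YoungDiagram, ∑ l, (lam l).card = N →
      ∃ p : Fin N → ℂ, (∀ i, p i ∈ D) ∧ HasMultiYoungShape a b u lam p) ∧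
    (∀ (p : Fin N → ℂ) (lam mu : Fin k → YoungDiagram),
      HasMultiYoungShape a b u lam p → HasMultiYoungShape a b u mu p → lam = mu) ∧
    (∀ (p q : Fin N → ℂ) (lam : Fin k → YoungDiagram),
      HasMultiYoungShape a b u lam p → HasMultiYoungShape a b u lam q →
        ∃ σ : Equiv.Perm (Fin N), q = p ∘ σ) ∧
    {p : Fin N → ℂ | (∀ i, p i ∈ D) ∧ res p ≠ 0}.Finite ∧
    TorusIntegrable (integrand a b w N) 0 (fun _ => 1) ∧
    contourIntegral a b w N = ∑ᶠ (p : Fin N → ℂ) (_ : ∀ i, p i ∈ D), res p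

end HallLittlewood

end

/-!
The argument rests on one observation: a variable whose contour is not hit by an arrow from the other
variables sees only the poles of the one-variable factor `w`, and taking its residue at such a simple
pole `s` leaves an integral of the same form in one variable less, with `w(z)` replaced by `w(z)`
times the pair factors of `z` and `s` (`link`). After residues have been taken at the points of a
finite set `S`, the one-variable factor is `dressed a b w S`. If `S` is the set of boxes of a tuple of
Young diagrams (`IsDiagram`), then near any point that lies below `S` in modulus the poles of
`dressed a b w S` are simple and sit exactly at the boxes that can be added to `S`: the arrows into a
point `q` are balanced by the zero coming from the box diagonally below `q` and by the double zero at
the points of `S` (`IsGeneric.order_count`, `IsSeeded.dressed_simplePole`).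

*Contributions of single tuples.* Arrows strictly decrease the modulus, so on a small torus around
`p` the variables can be integrated out in the order of decreasing `|p_i|`. Every step either adds a
box and produces a nonzero residue, or makes the integral vanish; entries equal to `0` make it vanish
because the pair factors are scale invariant (`coreIntegral_eq_zero`). So `p` contributes exactly if
its entries are distinct and form a diagram (`IsSeeded.exists_contribution`). That such sets of
complex numbers are the Young shapes of the theorem is combinatorics of generic parameters.

*The sum.* The integral over the unit torus is computed by shrinking the circles one at a time along
a geometric sequence of radii, whose ratio is so close to `1` that the pair factors stay regular in
the annuli that are swept out. The residues picked up obey the same recursion as the contributions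
(`coreIntegral_shrink`, `IsSeeded.coreIntegral_insert`), and when the torus has become small enough
nothing is left (`IsSeeded.coreIntegral_eq_zero_of_lt`).

*The index.* Enlarging the torus beyond the unit torus crosses no poles, and rescaling it back moves
the pole of `1 / (z - u)` towards the origin; in the limit the factor becomes `1 / z`
(`coreIntegral_shift_pole`).
-/

namespace HallLittlewood

open MeasureTheory Set Filter Function

/-! ### Iterated torus integrals -/

/-- The recurrence for torus integrals in which the distinguished variable is integrated first. -/
theorem torusIntegral_succAbove_inner {n : ℕ} {f : (Fin (n + 1) → ℂ) → ℂ} {c : Fin (n + 1) → ℂ}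
    {R : Fin (n + 1) → ℝ} (hf : TorusIntegrable f c R) (i : Fin (n + 1)) :
    (∯ z in T(c, R), f z) =
      ∯ y in T(c ∘ i.succAbove, R ∘ i.succAbove), ∮ x in C(c i, R i), f (i.insertNth x y) := by
  set e : ℝ × (Fin n → ℝ) ≃ᵐ (Fin (n + 1) → ℝ) :=
    (MeasurableEquiv.piFinSuccAbove (fun _ => ℝ) i).symm with he
  have hem : MeasurePreserving e :=
    (volume_preserving_piFinSuccAbove (fun _ : Fin (n + 1) => ℝ) i).symm _
  have heπ : (e ⁻¹' Icc 0 fun _ => 2 * Real.pi) =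
      Icc 0 (2 * Real.pi) ×ˢ Icc (0 : Fin n → ℝ) fun _ => 2 * Real.pi :=
    ((Fin.insertNthOrderIso (fun _ => ℝ) i).preimage_Icc _ _).trans (Icc_prod_eq _ _)
  have key := torusIntegral_succAbove hf i
  rw [key]
  have hint := hf.function_integrable
  rw [← hem.integrableOn_comp_preimage e.measurableEmbedding, heπ] at hint
  have hswap := integral_integral_swap (f := fun (θ : ℝ) (Θ : Fin n → ℝ) =>
      (∏ j, R j * Complex.exp (e (θ, Θ) j * Complex.I) * Complex.I : ℂ) •
        f (torusMap c R (e (θ, Θ))))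
      (μ := volume.restrict (Icc 0 (2 * Real.pi)))
      (ν := volume.restrict (Icc (0 : Fin n → ℝ) fun _ => 2 * Real.pi))
      (by
        rw [Measure.prod_restrict]
        exact hint)
  have hmap : ∀ (θ : ℝ) (Θ : Fin n → ℝ), torusMap c R (e (θ, Θ)) =
      i.insertNth (circleMap (c i) (R i) θ)
        (torusMap (c ∘ i.succAbove) (R ∘ i.succAbove) Θ) := by
    intro θ Θ
    funext j
    refine Fin.succAboveCases i ?_ (fun j => ?_) j <;>
      simp [e, torusMap, circleMap, MeasurableEquiv.piFinSuccAbove_symm_apply, Fin.insertNthEquiv]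
  have hprod : ∀ (θ : ℝ) (Θ : Fin n → ℝ),
      (∏ j, R j * Complex.exp (e (θ, Θ) j * Complex.I) * Complex.I : ℂ) =
      deriv (circleMap (c i) (R i)) θ *
        ∏ j, (R ∘ i.succAbove) j * Complex.exp (Θ j * Complex.I) * Complex.I := by
    intro θ Θ
    rw [i.prod_univ_succAbove]
    simp [e, deriv_circleMap, circleMap, MeasurableEquiv.piFinSuccAbove_symm_apply,
      Fin.insertNthEquiv]
  simp only [hmap, hprod] at hswap
  rw [circleIntegral_def_Icc]
  simp only [torusIntegral, circleIntegral_def_Icc]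
  refine Eq.trans ?_ (hswap.trans ?_)
  · refine setIntegral_congr_fun measurableSet_Icc fun θ _ => ?_
    simp only [← integral_smul, smul_smul]
  · refine setIntegral_congr_fun measurableSet_Icc fun θ _ => ?_
    simp only [← integral_smul, smul_smul]
    refine setIntegral_congr_fun measurableSet_Icc fun θ _ => ?_
    simp only [mul_comm]

theorem torusMap_mem_sphere {n : ℕ} (c : Fin n → ℂ) {R : Fin n → ℝ} (hR : ∀ i, 0 ≤ R i)
    (θ : Fin n → ℝ) (i : Fin n) : torusMap c R θ i ∈ Metric.sphere (c i) (R i) := by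
  have := circleMap_mem_sphere (c i) (hR i) (θ i)
  simpa [circleMap, torusMap] using this

theorem torusIntegral_congr {n : ℕ} {f g : (Fin n → ℂ) → ℂ} {c : Fin n → ℂ} {R : Fin n → ℝ}
    (hR : ∀ i, 0 ≤ R i) (h : ∀ z, (∀ i, z i ∈ Metric.sphere (c i) (R i)) → f z = g z) :
    (∯ z in T(c, R), f z) = ∯ z in T(c, R), g z := by
  unfold torusIntegral
  refine setIntegral_congr_fun measurableSet_Icc fun θ _ => ?_
  simp only [h _ (torusMap_mem_sphere c hR θ)]

theorem torusIntegrable_of_continuousOn {n : ℕ} {f : (Fin n → ℂ) → ℂ} {c : Fin n → ℂ}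
    {R : Fin n → ℝ} (hR : ∀ i, 0 ≤ R i)
    (hf : ContinuousOn f {z | ∀ i, z i ∈ Metric.sphere (c i) (R i)}) : TorusIntegrable f c R := by
  refine ContinuousOn.integrableOn_compact isCompact_Icc (Continuous.continuousOn ?_)
  refine hf.comp_continuous ?_ fun θ => torusMap_mem_sphere c hR θ
  unfold torusMap
  fun_prop

theorem torusIntegrable_congr {n : ℕ} {f g : (Fin n → ℂ) → ℂ} {c : Fin n → ℂ} {R : Fin n → ℝ}
    (hR : ∀ i, 0 ≤ R i) (h : ∀ z, (∀ i, z i ∈ Metric.sphere (c i) (R i)) → f z = g z)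
    (hf : TorusIntegrable f c R) : TorusIntegrable g c R := by
  refine IntegrableOn.congr_fun hf (fun θ _ => ?_) measurableSet_Icc
  simp only [h _ (torusMap_mem_sphere c hR θ)]

/-- A torus integral may be computed after relabelling the variables. -/
theorem torusIntegral_comp_perm {n : ℕ} (f : (Fin n → ℂ) → ℂ) (c : Fin n → ℂ) (R : Fin n → ℝ)
    (σ : Equiv.Perm (Fin n)) :
    (∯ z in T(c ∘ σ, R ∘ σ), f z) = ∯ z in T(c, R), f (z ∘ σ) := by
  have hem := volume_measurePreserving_piCongrLeft (fun _ : Fin n => ℝ) σ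
  symm
  unfold torusIntegral
  rw [← hem.setIntegral_preimage_emb (MeasurableEquiv.measurableEmbedding _)]
  have happ : ∀ (θ : Fin n → ℝ) (j : Fin n),
      (MeasurableEquiv.piCongrLeft (fun _ : Fin n => ℝ) σ) θ (σ j) = θ j := fun θ j =>
    Equiv.piCongrLeft_apply_apply (fun _ => ℝ) σ θ j
  have hpre : (MeasurableEquiv.piCongrLeft (fun _ : Fin n => ℝ) σ) ⁻¹'
      (Icc 0 fun _ => 2 * Real.pi) = Icc 0 fun _ => 2 * Real.pi := by
    ext θ
    simp only [mem_preimage, mem_Icc, Pi.le_def]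
    constructor
    · rintro ⟨h1, h2⟩
      exact ⟨fun j => by simpa [happ] using h1 (σ j), fun j => by simpa [happ] using h2 (σ j)⟩
    · rintro ⟨h1, h2⟩
      constructor <;> intro j <;> obtain ⟨j, rfl⟩ := σ.surjective j <;> rw [happ]
      exacts [h1 j, h2 j]
  rw [hpre]
  refine setIntegral_congr_fun measurableSet_Icc fun θ _ => ?_
  simp only
  congr 1
  · rw [← Equiv.prod_comp σ]
    simp [happ]
  · congr 1
    funext j
    simp [torusMap, happ]

/-- Substituting `z = r ζ` in the integral over the torus of radius `r` centred at `0`. -/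
theorem torusIntegral_zero_radius_eq {n : ℕ} (f : (Fin n → ℂ) → ℂ) (r : ℝ) :
    (∯ z in T(0, fun _ => r), f z) =
      (r : ℂ) ^ n * ∯ z in T(0, fun _ => 1), f (fun i => r * z i) := by
  rw [← torusIntegral_const_mul]
  unfold torusIntegral
  refine setIntegral_congr_fun measurableSet_Icc fun θ _ => ?_
  have : torusMap (0 : Fin n → ℂ) (fun _ => r) θ =
      fun i => (r : ℂ) * torusMap (0 : Fin n → ℂ) (fun _ => 1) θ i := by
    funext i; simp [torusMap]
  simp only [this, smul_eq_mul, ← mul_assoc]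
  congr 1
  simp only [Finset.prod_mul_distrib, Finset.prod_const, Finset.card_univ, Fintype.card_fin]
  simp
  ring

/-! ### Residues in one variable -/

/-- A function all of whose singularities in `K` are removable agrees with a function analytic on
`K`. -/
theorem exists_analyticAt_extension {f : ℂ → ℂ} {K : Set ℂ}
    (hf : ∀ q ∈ K, ∃ g, AnalyticAt ℂ g q ∧ f =ᶠ[𝓝[≠] q] g) :
    ∃ h : ℂ → ℂ, (∀ q ∈ K, AnalyticAt ℂ h q) ∧ ∀ q ∈ K, f =ᶠ[𝓝[≠] q] h := by
  have key : ∀ q ∈ K, ∃ g, AnalyticAt ℂ g q ∧ f =ᶠ[𝓝[≠] q] g ∧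
      (fun z => limUnder (𝓝[≠] z) f) =ᶠ[𝓝 q] g := by
    intro q hq
    obtain ⟨g, hg, hfg⟩ := hf q hq
    refine ⟨g, hg, hfg, ?_⟩
    have h1 := eventually_nhdsWithin_iff.1 hfg
    filter_upwards [h1.eventually_nhds, hg.eventually_analyticAt] with z hz hgz
    refine Tendsto.limUnder_eq ?_
    have hz' : f =ᶠ[𝓝[≠] z] g := by
      rcases eq_or_ne z q with rfl | hne
      · exact hfg
      · have : ∀ᶠ y in 𝓝 z, y ∈ ({q}ᶜ : Set ℂ) := isOpen_compl_singleton.mem_nhds hne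
        exact (hz.and this).filter_mono nhdsWithin_le_nhds |>.mono fun y hy => hy.1 hy.2
    exact (hgz.continuousAt.tendsto.mono_left nhdsWithin_le_nhds).congr' hz'.symm
  refine ⟨fun z => limUnder (𝓝[≠] z) f, fun q hq => ?_, fun q hq => ?_⟩
  · obtain ⟨g, hg, -, h⟩ := key q hq
    exact hg.congr h.symm
  · obtain ⟨g, hg, hfg, h⟩ := key q hq
    exact hfg.trans (h.filter_mono nhdsWithin_le_nhds).symm

theorem eq_of_eventuallyEq_punctured {f g : ℂ → ℂ} {q : ℂ} (hf : ContinuousAt f q)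
    (hg : ContinuousAt g q) (h : f =ᶠ[𝓝[≠] q] g) : f q = g q :=
  tendsto_nhds_unique ((hf.tendsto.mono_left nhdsWithin_le_nhds).congr' h)
    (hg.tendsto.mono_left nhdsWithin_le_nhds)

theorem circleIntegral_annulus_pole {K : ℂ → ℂ} {r R : ℝ} (hr : 0 < r) {s : ℂ} (hs : r < ‖s‖)
    (hs' : ‖s‖ < R) (hK : ∀ z : ℂ, r ≤ ‖z‖ → ‖z‖ ≤ R → AnalyticAt ℂ K z) :
    (∮ z in C(0, R), (z - s)⁻¹ * K z) =
      (∮ z in C(0, r), (z - s)⁻¹ * K z) + 2 * Real.pi * Complex.I * K s := by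
  have hrR : r ≤ R := (hs.trans hs').le
  have hR : 0 < R := hr.trans_le hrR
  set U : Set ℂ := {z | AnalyticAt ℂ K z} with hU
  have hUo : IsOpen U := isOpen_analyticAt ℂ K
  have hdU : DifferentiableOn ℂ (dslope K s) U := by
    rw [Complex.differentiableOn_dslope (hUo.mem_nhds (hK s hs.le hs'.le))]
    exact fun z hz => hz.differentiableAt.differentiableWithinAt
  have hsplit : ∀ z, z ≠ s → (z - s)⁻¹ * K z = dslope K s z + K s * (z - s)⁻¹ := by
    intro z hz
    rw [dslope_of_ne _ hz, slope_def_field]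
    have : z - s ≠ 0 := sub_ne_zero.2 hz
    field_simp
    ring
  have hmem : ∀ z : ℂ, r ≤ ‖z‖ → ‖z‖ ≤ R → z ∈ U := hK
  have hci : ∀ ρ : ℝ, r ≤ ρ → ρ ≤ R → ρ ≠ ‖s‖ →
      (∮ z in C(0, ρ), (z - s)⁻¹ * K z) =
        (∮ z in C(0, ρ), dslope K s z) + K s * ∮ z in C(0, ρ), (z - s)⁻¹ := by
    intro ρ h1 h2 h3
    have hρ : 0 ≤ ρ := hr.le.trans h1
    have hne : ∀ z ∈ Metric.sphere (0 : ℂ) ρ, z ≠ s := by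
      rintro z hz rfl
      exact h3 (by simpa using hz.symm)
    rw [circleIntegral.integral_congr hρ (g := fun z => dslope K s z + K s * (z - s)⁻¹)
      (fun z hz => hsplit z (hne z hz)), circleIntegral.integral_add,
      circleIntegral.integral_const_mul]
    · refine ContinuousOn.circleIntegrable hρ (hdU.continuousOn.mono fun z hz => ?_)
      have : ‖z‖ = ρ := by simpa using hz
      exact hmem z (by linarith) (by linarith)
    · refine ContinuousOn.circleIntegrable hρ ?_
      refine continuousOn_const.mul (ContinuousOn.inv₀ (by fun_prop) fun z hz => ?_)
      exact sub_ne_zero.2 (hne z hz)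
  have hann : (∮ z in C(0, R), dslope K s z) = ∮ z in C(0, r), dslope K s z := by
    refine Complex.circleIntegral_eq_of_differentiable_on_annulus_off_countable hr hrR
      countable_empty (hdU.continuousOn.mono ?_) ?_
    · rintro z ⟨h1, h2⟩
      exact hmem z (by simpa using h2) (by simpa using h1)
    · rintro z ⟨⟨h1, h2⟩, -⟩
      refine hdU.differentiableAt (hUo.mem_nhds (hmem z ?_ ?_))
      · simpa using (not_le.1 (by simpa using h2) : r < ‖z‖).le
      · simpa using (by simpa using h1 : ‖z‖ < R).le
  have hzero : (∮ z in C(0, r), (z - s)⁻¹) = 0 := by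
    refine Complex.circleIntegral_eq_zero_of_differentiable_on_off_countable hr.le
      countable_empty (ContinuousOn.inv₀ (by fun_prop) ?_) ?_
    · intro z hz h0
      have : ‖z‖ ≤ r := by simpa using hz
      rw [sub_eq_zero] at h0
      rw [h0] at this
      linarith
    · rintro z ⟨hz, -⟩
      refine DifferentiableAt.inv (by fun_prop) ?_
      intro h0
      have : ‖z‖ < r := by simpa using hz
      rw [sub_eq_zero] at h0
      rw [h0] at this
      linarith
  rw [hci R hrR le_rfl hs'.ne', hci r le_rfl hrR hs.ne, hann, hzero,
    circleIntegral.integral_sub_inv_of_mem_ball (by simpa using hs')]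
  ring

/-- The residue theorem in an annulus for a function with simple poles, given by its principal
parts, times an analytic function. -/
theorem circleIntegral_annulus_simplePoles {w h K : ℂ → ℂ} {r R : ℝ} (hr : 0 < r) (hrR : r ≤ R)
    (P : Finset ℂ) (res : ℂ → ℂ) (hP : ∀ s ∈ P, r < ‖s‖ ∧ ‖s‖ < R)
    (hh : ∀ z : ℂ, r ≤ ‖z‖ → ‖z‖ ≤ R → AnalyticAt ℂ h z)
    (hK : ∀ z : ℂ, r ≤ ‖z‖ → ‖z‖ ≤ R → AnalyticAt ℂ K z)
    (hwr : ∀ z : ℂ, ‖z‖ = r → w z = h z + ∑ s ∈ P, res s * (z - s)⁻¹)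
    (hwR : ∀ z : ℂ, ‖z‖ = R → w z = h z + ∑ s ∈ P, res s * (z - s)⁻¹) :
    (∮ z in C(0, R), w z * K z) =
      (∮ z in C(0, r), w z * K z) + ∑ s ∈ P, 2 * Real.pi * Complex.I * res s * K s := by
  have hexp : ∀ ρ : ℝ, r ≤ ρ → ρ ≤ R → (∀ s ∈ P, ρ ≠ ‖s‖) →
      (∀ z : ℂ, ‖z‖ = ρ → w z = h z + ∑ s ∈ P, res s * (z - s)⁻¹) →
      (∮ z in C(0, ρ), w z * K z) =
        (∮ z in C(0, ρ), h z * K z) + ∑ s ∈ P, res s * ∮ z in C(0, ρ), (z - s)⁻¹ * K z := by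
    intro ρ h1 h2 h3 h4
    have hρ : 0 ≤ ρ := hr.le.trans h1
    have hKc : ContinuousOn K (Metric.sphere 0 ρ) := fun z hz => by
      have : ‖z‖ = ρ := by simpa using hz
      exact (hK z (by linarith) (by linarith)).continuousAt.continuousWithinAt
    have hhc : ContinuousOn h (Metric.sphere 0 ρ) := fun z hz => by
      have : ‖z‖ = ρ := by simpa using hz
      exact (hh z (by linarith) (by linarith)).continuousAt.continuousWithinAt
    have hpc : ∀ s ∈ P, CircleIntegrable (fun z => res s * ((z - s)⁻¹ * K z)) 0 ρ := by
      intro s hs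
      refine ContinuousOn.circleIntegrable hρ (continuousOn_const.mul
        ((ContinuousOn.inv₀ (by fun_prop) fun z hz => ?_).mul hKc))
      intro h0
      rw [sub_eq_zero] at h0
      exact h3 s hs (by simpa [h0] using hz.symm)
    rw [circleIntegral.integral_congr hρ
      (g := fun z => h z * K z + ∑ s ∈ P, res s * ((z - s)⁻¹ * K z)),
      circleIntegral.integral_add (f := fun z => h z * K z)
        (ContinuousOn.circleIntegrable hρ (hhc.mul hKc)) ?_]
    · congr 1
      rw [circleIntegral.integral_fun_sum hpc]
      simp only [circleIntegral.integral_const_mul]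
    · exact CircleIntegrable.fun_sum P hpc
    · intro z hz
      simp only
      rw [h4 z (by simpa using hz), add_mul, Finset.sum_mul]
      simp only [mul_assoc]
  rw [hexp R hrR le_rfl (fun s hs => (hP s hs).2.ne') hwR,
    hexp r le_rfl hrR (fun s hs => (hP s hs).1.ne) hwr, add_assoc, ← Finset.sum_add_distrib]
  congr 1
  · refine Complex.circleIntegral_eq_of_differentiable_on_annulus_off_countable hr hrR
      countable_empty ?_ ?_
    · rintro z ⟨h1, h2⟩
      have h1 : ‖z‖ ≤ R := by simpa using h1
      have h2 : r ≤ ‖z‖ := by simpa using h2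
      exact ((hh z h2 h1).continuousAt.mul (hK z h2 h1).continuousAt).continuousWithinAt
    · rintro z ⟨⟨h1, h2⟩, -⟩
      have h1 : ‖z‖ < R := by simpa using h1
      have h2 : r < ‖z‖ := by simpa using h2
      exact (hh z h2.le h1.le).differentiableAt.mul (hK z h2.le h1.le).differentiableAt
  · refine Finset.sum_congr rfl fun s hs => ?_
    rw [circleIntegral_annulus_pole hr (hP s hs).1 (hP s hs).2 hK]
    ring

/-! ### The integrand as a product of one- and two-variable factors -/

/-- The factor of an ordered pair of variables with denominators cleared; it agrees with
`pairFactor` for `y ≠ 0`. -/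
noncomputable def crossFactor (a b x y : ℂ) : ℂ :=
  (y - x) * (y - a * b * x) / ((y - a * x) * (y - b * x))

/-- The joint factor of an unordered pair of variables. -/
noncomputable def link (a b x y : ℂ) : ℂ := crossFactor a b x y * crossFactor a b y x

/-- The integrand without its constants. -/
noncomputable def core (a b : ℂ) (w : ℂ → ℂ) {N : ℕ} (z : Fin N → ℂ) : ℂ :=
  (∏ i, w (z i)) * ∏ q ∈ (Finset.univ : Finset (Fin N)).offDiag, crossFactor a b (z q.1) (z q.2)

/-- The constant in front of `core` in the integrand. -/
noncomputable def prefactor (a b : ℂ) (N : ℕ) : ℂ :=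
  1 / (N.factorial : ℂ) * ((1 - a * b) / ((1 - a) * (1 - b))) ^ N *
    (1 / (2 * (Real.pi : ℂ) * Complex.I)) ^ N

theorem pairFactor_eq_crossFactor {a b x y : ℂ} (hy : y ≠ 0) :
    pairFactor a b x y = crossFactor a b x y := by
  unfold pairFactor crossFactor
  have e1 : 1 - x / y = (y - x) / y := by field_simp
  have e2 : ∀ c : ℂ, 1 - c * (x / y) = (y - c * x) / y := by intro c; field_simp
  rw [e1, e2, e2, e2, div_mul_div_comm, div_mul_div_comm,
    div_div_div_cancel_right₀ (mul_ne_zero hy hy)]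

theorem integrand_eq_core {a b : ℂ} (w : ℂ → ℂ) {N : ℕ} {z : Fin N → ℂ} (hz : ∀ i, z i ≠ 0) :
    integrand a b w N z = prefactor a b N * core a b w z := by
  unfold integrand prefactor core
  rw [Finset.prod_congr rfl fun q _ => pairFactor_eq_crossFactor (hz q.2), Finset.prod_div_distrib]
  simp only [Finset.prod_const, Finset.card_univ, Fintype.card_fin]
  generalize 2 * (Real.pi : ℂ) * Complex.I = c
  rw [div_eq_mul_inv _ (c ^ N), one_div c, inv_pow]
  ring

theorem core_congr {a b : ℂ} {w w' : ℂ → ℂ} {N : ℕ} {z : Fin N → ℂ}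
    (h : ∀ i, w (z i) = w' (z i)) : core a b w z = core a b w' z := by
  unfold core
  rw [Finset.prod_congr rfl fun i _ => h i]

theorem core_eq (a b : ℂ) (w : ℂ → ℂ) {N : ℕ} (z : Fin N → ℂ) :
    core a b w z = (∏ i, w (z i)) *
      ∏ m, ∏ n, if m = n then 1 else crossFactor a b (z m) (z n) := by
  unfold core
  congr 1
  rw [← Finset.prod_product', Finset.univ_product_univ]
  have : (Finset.univ : Finset (Fin N)).offDiag =
      (Finset.univ : Finset (Fin N × Fin N)).filter fun q => q.1 ≠ q.2 := by
    ext q; simp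
  rw [this, Finset.prod_filter]
  refine Finset.prod_congr rfl fun q _ => ?_
  by_cases h : q.1 = q.2 <;> simp [h]

/-- Separating one variable in the integrand. -/
theorem core_insertNth (a b : ℂ) (w : ℂ → ℂ) {n : ℕ} (i : Fin (n + 1)) (x : ℂ) (y : Fin n → ℂ) :
    core a b w (i.insertNth x y : Fin (n + 1) → ℂ) =
      core a b w y * (w x * ∏ j, link a b x (y j)) := by
  unfold link
  rw [core_eq, core_eq, i.prod_univ_succAbove, i.prod_univ_succAbove]
  simp only [i.prod_univ_succAbove, Fin.insertNth_apply_same, Fin.insertNth_apply_succAbove,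
    if_true, Fin.succAbove_right_inj, Fin.succAbove_ne, (Fin.succAbove_ne i _).symm, if_false,
    one_mul, Finset.prod_mul_distrib]
  ring

theorem core_mul_link (a b : ℂ) (w : ℂ → ℂ) {n : ℕ} (x : ℂ) (y : Fin n → ℂ) :
    core a b (fun z => w z * link a b x z) y = core a b w y * ∏ j, link a b x (y j) := by
  unfold core
  rw [Finset.prod_mul_distrib]
  ring

theorem core_comp_perm (a b : ℂ) (w : ℂ → ℂ) {n : ℕ} (z : Fin n → ℂ) (σ : Equiv.Perm (Fin n)) :
    core a b w (z ∘ σ) = core a b w z := by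
  rw [core_eq, core_eq]
  congr 1
  · exact Equiv.prod_comp σ fun i => w (z i)
  · symm
    rw [← Equiv.prod_comp σ]
    refine Finset.prod_congr rfl fun m _ => ?_
    rw [← Equiv.prod_comp σ]
    simp

theorem crossFactor_analyticAt {a b x : ℂ} {y : ℂ} (h1 : y ≠ a * x) (h2 : y ≠ b * x) :
    AnalyticAt ℂ (fun x' => crossFactor a b x' y) x ∧
      AnalyticAt ℂ (fun y' => crossFactor a b x y') y := by
  unfold crossFactor
  have : (y - a * x) * (y - b * x) ≠ 0 := mul_ne_zero (sub_ne_zero.2 h1) (sub_ne_zero.2 h2)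
  exact ⟨AnalyticAt.div (by fun_prop) (by fun_prop) this,
    AnalyticAt.div (by fun_prop) (by fun_prop) this⟩

theorem link_comm (a b x y : ℂ) : link a b x y = link a b y x := mul_comm _ _

theorem link_analyticAt {a b x y : ℂ} (h1 : y ≠ a * x) (h2 : y ≠ b * x) (h3 : x ≠ a * y)
    (h4 : x ≠ b * y) : AnalyticAt ℂ (fun x' => link a b x' y) x :=
  (crossFactor_analyticAt h1 h2).1.mul (crossFactor_analyticAt h3 h4).2

/-! ### Integrating out one variable -/

/-- The integral of `core` over the product of the circles `|z_i - p_i| = R_i`. -/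
noncomputable def coreIntegral (a b : ℂ) (w : ℂ → ℂ) {N : ℕ} (p : Fin N → ℂ) (R : Fin N → ℝ) : ℂ :=
  ∯ z in T(p, R), core a b w z

/-- No pair of variables on the circles `|z_i - p_i| = R_i` meets a pole of the pair factors. -/
def Separated (a b : ℂ) {N : ℕ} (p : Fin N → ℂ) (R : Fin N → ℝ) : Prop :=
  ∀ i j, i ≠ j → ∀ x ∈ Metric.sphere (p i) (R i), ∀ y ∈ Metric.sphere (p j) (R j),
    y ≠ a * x ∧ y ≠ b * x

theorem core_continuousOn {a b : ℂ} {w : ℂ → ℂ} {N : ℕ} {p : Fin N → ℂ} {R : Fin N → ℝ}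
    (hs : Separated a b p R) (hw : ∀ i, ContinuousOn w (Metric.sphere (p i) (R i))) :
    ContinuousOn (core a b w) {z | ∀ i, z i ∈ Metric.sphere (p i) (R i)} := by
  unfold core
  refine ContinuousOn.mul ?_ ?_
  · refine continuousOn_finsetProd _ fun i _ => ?_
    exact (hw i).comp (continuous_apply i).continuousOn fun z hz => hz i
  · refine continuousOn_finsetProd _ fun q hq => ?_
    have hne : q.1 ≠ q.2 := by simpa using hq
    unfold crossFactor
    refine ContinuousOn.div (by fun_prop) (by fun_prop) fun z hz => ?_
    have := hs _ _ hne _ (hz q.1) _ (hz q.2)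
    exact mul_ne_zero (sub_ne_zero.2 this.1) (sub_ne_zero.2 this.2)

theorem core_torusIntegrable {a b : ℂ} {w : ℂ → ℂ} {N : ℕ} {p : Fin N → ℂ} {R : Fin N → ℝ}
    (hR : ∀ i, 0 ≤ R i) (hs : Separated a b p R)
    (hw : ∀ i, ContinuousOn w (Metric.sphere (p i) (R i))) : TorusIntegrable (core a b w) p R :=
  torusIntegrable_of_continuousOn hR (core_continuousOn hs hw)

theorem coreIntegral_congr {a b : ℂ} {w w' : ℂ → ℂ} {N : ℕ} {p : Fin N → ℂ} {R : Fin N → ℝ}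
    (hR : ∀ i, 0 ≤ R i) (h : ∀ i, ∀ z ∈ Metric.sphere (p i) (R i), w z = w' z) :
    coreIntegral a b w p R = coreIntegral a b w' p R :=
  torusIntegral_congr hR fun z hz => core_congr fun i => h i (z i) (hz i)

theorem coreIntegral_eq_inner {a b : ℂ} {w : ℂ → ℂ} {n : ℕ} {p : Fin (n + 1) → ℂ}
    {R : Fin (n + 1) → ℝ} (hR : ∀ i, 0 ≤ R i) (hs : Separated a b p R)
    (hw : ∀ i, ContinuousOn w (Metric.sphere (p i) (R i))) (i : Fin (n + 1)) :
    coreIntegral a b w p R = ∯ y in T(p ∘ i.succAbove, R ∘ i.succAbove),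
      core a b w y * ∮ x in C(p i, R i), w x * ∏ j, link a b x (y j) := by
  unfold coreIntegral
  rw [torusIntegral_succAbove_inner (core_torusIntegrable hR hs hw) i]
  simp only [core_insertNth, circleIntegral.integral_const_mul]

theorem inner_torusIntegrable {n : ℕ} {f : (Fin (n + 1) → ℂ) → ℂ} {p : Fin (n + 1) → ℂ}
    {R : Fin (n + 1) → ℝ} (hR : ∀ i, 0 ≤ R i)
    (hf : ContinuousOn f {z | ∀ i, z i ∈ Metric.sphere (p i) (R i)}) (i : Fin (n + 1)) :
    TorusIntegrable (fun y : Fin n → ℂ => ∮ x in C(p i, R i), f (i.insertNth x y))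
      (p ∘ i.succAbove) (R ∘ i.succAbove) := by
  refine ContinuousOn.integrableOn_compact isCompact_Icc (Continuous.continuousOn ?_)
  unfold circleIntegral
  refine intervalIntegral.continuous_parametric_intervalIntegral_of_continuous' ?_ _ _
  simp only [deriv_circleMap, Function.uncurry_def]
  refine Continuous.smul (f := fun q : (Fin n → ℝ) × ℝ => circleMap 0 (R i) q.2 * Complex.I)
    (by fun_prop) ?_
  refine hf.comp_continuous ?_ ?_
  · refine continuous_pi fun j => ?_
    refine Fin.succAboveCases i ?_ (fun j => ?_) j
    · simp only [Fin.insertNth_apply_same]; fun_prop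
    · simp only [Fin.insertNth_apply_succAbove, torusMap]; fun_prop
  · rintro ⟨Θ, θ⟩ j
    refine Fin.succAboveCases i ?_ (fun j => ?_) j
    · simpa using circleMap_mem_sphere (p i) (hR i) θ
    · simp only [Fin.insertNth_apply_succAbove]
      exact torusMap_mem_sphere (p ∘ i.succAbove) (R := R ∘ i.succAbove) (fun j => hR _) Θ j

/-! ### Small tori -/

theorem eventually_closedBall_of_punctured {c : ℂ} {P : ℂ → Prop} (h : ∀ᶠ z in 𝓝[≠] c, P z) :
    ∀ᶠ ε : ℝ in 𝓝[>] 0, ∀ z ∈ Metric.closedBall c ε, z ≠ c → P z := by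
  rw [eventually_nhdsWithin_iff, Metric.eventually_nhds_iff] at h
  obtain ⟨δ, hδ, h⟩ := h
  filter_upwards [Ioo_mem_nhdsGT hδ] with ε hε z hz hne
  exact h (lt_of_le_of_lt (Metric.mem_closedBall.1 hz) hε.2) hne

theorem eventually_closedBall_of_nhds {c : ℂ} {P : ℂ → Prop} (h : ∀ᶠ z in 𝓝 c, P z) :
    ∀ᶠ ε : ℝ in 𝓝[>] 0, ∀ z ∈ Metric.closedBall c ε, P z := by
  filter_upwards [eventually_closedBall_of_punctured (h.filter_mono nhdsWithin_le_nhds)]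
    with ε hε z hz
  rcases eq_or_ne z c with rfl | hne
  · exact h.self_of_nhds
  · exact hε z hz hne

theorem eventually_ne_mul_of_ne {a p q : ℂ} (h : q ≠ a * p) :
    ∀ᶠ ε : ℝ in 𝓝[>] 0, ∀ x ∈ Metric.closedBall p ε, ∀ y ∈ Metric.closedBall q ε, y ≠ a * x := by
  have hpos : 0 < ‖q - a * p‖ / (1 + ‖a‖) := by
    have := norm_pos_iff.2 (sub_ne_zero.2 h)
    positivity
  filter_upwards [Ioo_mem_nhdsGT hpos] with ε hε x hx y hy hxy
  have h1 : ‖x - p‖ ≤ ε := by simpa [dist_eq_norm] using hx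
  have h2 : ‖y - q‖ ≤ ε := by simpa [dist_eq_norm] using hy
  have h3 : q - a * p = -(y - q) + a * (x - p) := by rw [hxy]; ring
  have h4 : ‖q - a * p‖ ≤ ε + ‖a‖ * ε := by
    rw [h3]
    refine (norm_add_le _ _).trans ?_
    rw [norm_neg, norm_mul]
    gcongr
  have h5 := (lt_div_iff₀ (by positivity)).1 hε.2
  linarith

/-- If `q = a p`, then multiplication by `a` maps the disc around `p` strictly inside the circle of
the same radius around `q`; so on small circles the pole at `y = a x` is always avoided. -/
theorem eventually_ne_mul {a : ℂ} (ha : ‖a‖ < 1) (p q : ℂ) :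
    ∀ᶠ ε : ℝ in 𝓝[>] 0, ∀ x ∈ Metric.closedBall p ε, ∀ y ∈ Metric.sphere q ε, y ≠ a * x := by
  by_cases h : q = a * p
  · filter_upwards [self_mem_nhdsWithin] with ε hε x hx y hy hxy
    have hε : 0 < ε := hε
    have h1 : ‖x - p‖ ≤ ε := by simpa [dist_eq_norm] using hx
    have h2 : ‖y - q‖ = ε := by simpa [dist_eq_norm] using hy
    have h3 : y - q = a * (x - p) := by rw [hxy, h]; ring
    rw [h3, norm_mul] at h2
    nlinarith [norm_nonneg a, norm_nonneg (x - p)]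
  · filter_upwards [eventually_ne_mul_of_ne h] with ε hε x hx y hy
    exact hε x hx y (Metric.sphere_subset_closedBall hy)

theorem eventually_separated {a b : ℂ} (ha : ‖a‖ < 1) (hb : ‖b‖ < 1) {N : ℕ} (p : Fin N → ℂ) :
    ∀ᶠ ε : ℝ in 𝓝[>] 0, Separated a b p fun _ => ε := by
  unfold Separated
  simp only [eventually_all]
  intro i j _
  filter_upwards [eventually_ne_mul ha (p i) (p j), eventually_ne_mul hb (p i) (p j)]
    with ε h1 h2 x hx y hy
  have hx := Metric.sphere_subset_closedBall hx
  exact ⟨h1 x hx y hy, h2 x hx y hy⟩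

theorem eventually_continuousOn_sphere {w : ℂ → ℂ} {N : ℕ} {p : Fin N → ℂ}
    (hw : ∀ i, MeromorphicAt w (p i)) :
    ∀ᶠ ε : ℝ in 𝓝[>] 0, ∀ i, ContinuousOn w (Metric.sphere (p i) ε) := by
  rw [eventually_all]
  intro i
  filter_upwards [eventually_closedBall_of_punctured (hw i).eventually_analyticAt,
    self_mem_nhdsWithin] with ε hε hpos z hz
  have hpos : 0 < ε := hpos
  refine (hε z (Metric.sphere_subset_closedBall hz) ?_).continuousAt.continuousWithinAt
  exact Metric.ne_of_mem_sphere hz hpos.ne'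

/-- Integrating out a variable on a small circle whose centre is not hit by an arrow from the other
centres: the only possible pole inside is that of `w`. -/
theorem coreIntegral_small_step {a b : ℂ} (ha : ‖a‖ < 1) (hb : ‖b‖ < 1) {w : ℂ → ℂ} {n : ℕ}
    {p : Fin (n + 1) → ℂ} (i : Fin (n + 1))
    (hp : ∀ j, p i ≠ a * p (i.succAbove j) ∧ p i ≠ b * p (i.succAbove j))
    (hw : ∀ j, MeromorphicAt w (p j)) {g : ℂ → ℂ} (hg : AnalyticAt ℂ g (p i))
    (hwg : ∀ᶠ z in 𝓝[≠] (p i), w z = (z - p i)⁻¹ * g z) :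
    ∀ᶠ ε : ℝ in 𝓝[>] 0, coreIntegral a b w p (fun _ => ε) =
      2 * Real.pi * Complex.I * g (p i) *
        coreIntegral a b (fun z => w z * link a b (p i) z) (p ∘ i.succAbove) (fun _ => ε) := by
  have hlink : ∀ᶠ ε : ℝ in 𝓝[>] 0, ∀ j, ∀ x ∈ Metric.closedBall (p i) ε,
      ∀ y ∈ Metric.sphere (p (i.succAbove j)) ε, AnalyticAt ℂ (fun x' => link a b x' y) x := by
    rw [eventually_all]
    intro j
    filter_upwards [eventually_ne_mul ha (p i) (p (i.succAbove j)),
      eventually_ne_mul hb (p i) (p (i.succAbove j)), eventually_ne_mul_of_ne (hp j).1,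
      eventually_ne_mul_of_ne (hp j).2] with ε h1 h2 h3 h4 x hx y hy
    have hy' := Metric.sphere_subset_closedBall hy
    exact link_analyticAt (h1 x hx y hy) (h2 x hx y hy) (h3 y hy' x hx) (h4 y hy' x hx)
  filter_upwards [eventually_separated ha hb p, eventually_continuousOn_sphere hw, hlink,
    eventually_closedBall_of_punctured hwg,
    eventually_closedBall_of_nhds hg.eventually_analyticAt, self_mem_nhdsWithin]
    with ε hsep hcont hlink hwg hg hε
  have hε : 0 < ε := hε
  rw [coreIntegral_eq_inner (fun _ => hε.le) hsep hcont i, coreIntegral, ← torusIntegral_const_mul]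
  refine torusIntegral_congr (fun _ => hε.le) fun y hy => ?_
  rw [core_mul_link]
  have han : ∀ x ∈ Metric.closedBall (p i) ε,
      AnalyticAt ℂ (fun x => g x * ∏ j, link a b x (y j)) x := fun x hx =>
    (hg x hx).mul (Finset.analyticAt_fun_prod _ fun j _ => hlink j x hx (y j) (hy j))
  have hdiff : DifferentiableOn ℂ (fun x => g x * ∏ j, link a b x (y j))
      (Metric.closedBall (p i) ε) := fun x hx => (han x hx).differentiableAt.differentiableWithinAt
  have hcau := hdiff.circleIntegral_sub_inv_smul (Metric.mem_ball_self hε)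
  rw [circleIntegral.integral_congr hε.le
    (g := fun x => (x - p i)⁻¹ • (g x * ∏ j, link a b x (y j))), hcau]
  · simp only [smul_eq_mul]
    ring
  · intro x hx
    simp only [smul_eq_mul]
    rw [hwg x (Metric.sphere_subset_closedBall hx) (Metric.ne_of_mem_sphere hx hε.ne'), mul_assoc]

/-! ### Tori centred at the origin -/

theorem separated_zero {a b : ℂ} {N : ℕ} {R : Fin N → ℝ} {m M : ℝ} (hm : ∀ i, m ≤ R i)
    (hM : ∀ i, R i ≤ M) (ha : ‖a‖ * M < m) (hb : ‖b‖ * M < m) : Separated a b 0 R := by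
  intro i j _ x hx y hy
  have hx : ‖x‖ = R i := by simpa using hx
  have hy : ‖y‖ = R j := by simpa using hy
  have h1 := hm j
  have h2 := hM i
  constructor <;> rintro rfl <;> rw [norm_mul, hx] at hy
  · nlinarith [norm_nonneg a]
  · nlinarith [norm_nonneg b]

/-- Shrinking the circle of one variable picks up the residues at the simple poles of `w` in the
annulus that is swept out, and no others: the radii are too close to each other for the pair
factors to have poles there. -/
theorem coreIntegral_shrink {a b : ℂ} {w h : ℂ → ℂ} {n : ℕ} {R : Fin (n + 1) → ℝ} {m M r : ℝ}
    (hm0 : 0 < m) (hm : ∀ i, m ≤ R i) (hM : ∀ i, R i ≤ M) (ha : ‖a‖ * M < m) (hb : ‖b‖ * M < m)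
    (i : Fin (n + 1)) (hmr : m ≤ r) (hrR : r ≤ R i)
    (hw : ∀ j, ContinuousOn w (Metric.sphere 0 (R j))) (hwr : ContinuousOn w (Metric.sphere 0 r))
    (P : Finset ℂ) (res : ℂ → ℂ) (hP : ∀ s ∈ P, r < ‖s‖ ∧ ‖s‖ < R i)
    (hh : ∀ z : ℂ, r ≤ ‖z‖ → ‖z‖ ≤ R i → AnalyticAt ℂ h z)
    (h1 : ∀ z : ℂ, ‖z‖ = r → w z = h z + ∑ s ∈ P, res s * (z - s)⁻¹)
    (h2 : ∀ z : ℂ, ‖z‖ = R i → w z = h z + ∑ s ∈ P, res s * (z - s)⁻¹) :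
    coreIntegral a b w 0 R = coreIntegral a b w 0 (update R i r) +
      ∑ s ∈ P, 2 * Real.pi * Complex.I * res s *
        coreIntegral a b (fun z => w z * link a b s z) 0 (R ∘ i.succAbove) := by
  have hr : 0 < r := hm0.trans_le hmr
  have hR0 : ∀ j, 0 ≤ R j := fun j => hm0.le.trans (hm j)
  have hlink : ∀ x : ℂ, r ≤ ‖x‖ → ‖x‖ ≤ R i → ∀ j, ∀ y : ℂ, ‖y‖ = R j →
      AnalyticAt ℂ (fun x' => link a b x' y) x ∧ AnalyticAt ℂ (fun y' => link a b x y') y := by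
    intro x hx1 hx2 j y hy
    have hj1 := hm j
    have hj2 := hM j
    have hi2 := hM i
    have e : ∀ c : ℂ, ‖c‖ * M < m → y ≠ c * x ∧ x ≠ c * y := by
      intro c hc
      constructor <;> intro h0
      · rw [h0, norm_mul] at hy
        nlinarith [norm_nonneg c]
      · rw [h0, norm_mul] at hx1
        nlinarith [norm_nonneg c]
    refine ⟨link_analyticAt (e a ha).1 (e b hb).1 (e a ha).2 (e b hb).2, ?_⟩
    simp_rw [link_comm a b x]
    exact link_analyticAt (e a ha).2 (e b hb).2 (e a ha).1 (e b hb).1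
  have hupm : ∀ j, m ≤ update R i r j := fun j => by
    rcases eq_or_ne j i with rfl | hj <;> simp [*]
  have hupM : ∀ j, update R i r j ≤ M := fun j => by
    rcases eq_or_ne j i with rfl | hj <;> simp [*]
    exact hrR.trans (hM _)
  have hup0 : ∀ j, 0 ≤ update R i r j := fun j => hm0.le.trans (hupm j)
  have hupw : ∀ j, ContinuousOn w (Metric.sphere ((0 : Fin (n + 1) → ℂ) j) (update R i r j)) := by
    intro j
    rcases eq_or_ne j i with rfl | hj
    · simpa using hwr
    · simpa [hj] using hw j
  have hsep := separated_zero hm hM ha hb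
  have hsep' := separated_zero hupm hupM ha hb
  have hcomp : update R i r ∘ i.succAbove = R ∘ i.succAbove := by
    funext j; simp
  rw [coreIntegral_eq_inner hR0 hsep hw i, coreIntegral_eq_inner hup0 hsep' hupw i, hcomp]
  simp only [update_self, Pi.zero_apply]
  have hinner : ∀ y : Fin n → ℂ, (∀ j, y j ∈ Metric.sphere 0 ((R ∘ i.succAbove) j)) →
      core a b w y * (∮ x in C(0, R i), w x * ∏ j, link a b x (y j)) =
      core a b w y * (∮ x in C(0, r), w x * ∏ j, link a b x (y j)) +
      ∑ s ∈ P, 2 * Real.pi * Complex.I * res s * core a b (fun z => w z * link a b s z) y := by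
    intro y hy
    have := circleIntegral_annulus_simplePoles (w := w) (h := h)
      (K := fun x => ∏ j, link a b x (y j)) hr hrR P res hP hh
      (fun z hz1 hz2 => Finset.analyticAt_fun_prod _ fun j _ =>
        (hlink z hz1 hz2 _ (y j) (by simpa using hy j)).1) h1 h2
    rw [this, mul_add, Finset.mul_sum]
    congr 1
    refine Finset.sum_congr rfl fun s _ => ?_
    rw [core_mul_link]
    ring
  have hint1 : TorusIntegrable (fun y : Fin n → ℂ => core a b w y *
      ∮ x in C(0, r), w x * ∏ j, link a b x (y j)) 0 (R ∘ i.succAbove) := by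
    have := inner_torusIntegrable hup0 (core_continuousOn hsep' hupw) i
    simp only [core_insertNth, circleIntegral.integral_const_mul, hcomp, update_self,
      Pi.zero_apply] at this
    exact this
  have hint2 : ∀ s ∈ P, TorusIntegrable (core a b (fun z => w z * link a b s z)) 0
      (R ∘ i.succAbove) := by
    intro s hs
    refine core_torusIntegrable (fun j => hR0 _)
      (separated_zero (fun j => hm _) (fun j => hM _) ha hb) fun j => ?_
    refine (hw _).mul fun y hy => ?_
    exact (hlink s (hP s hs).1.le (hP s hs).2.le (i.succAbove j) y
      (by simpa using hy)).2.continuousAt.continuousWithinAt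
  have hsum : ∀ Q ⊆ P,
      TorusIntegrable (fun y : Fin n → ℂ => ∑ s ∈ Q, 2 * Real.pi * Complex.I * res s *
        core a b (fun z => w z * link a b s z) y) 0 (R ∘ i.succAbove) ∧
      (∯ y in T((0 : Fin n → ℂ), R ∘ i.succAbove), ∑ s ∈ Q, 2 * Real.pi * Complex.I * res s *
        core a b (fun z => w z * link a b s z) y) = ∑ s ∈ Q, 2 * Real.pi * Complex.I * res s *
          coreIntegral a b (fun z => w z * link a b s z) 0 (R ∘ i.succAbove) := by
    intro Q
    induction Q using Finset.induction_on with
    | empty =>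
      intro _
      simp only [Finset.sum_empty]
      exact ⟨TorusIntegrable.torusIntegrable_const 0 _ _, by simp [torusIntegral]⟩
    | insert s Q hsQ ih =>
      intro hQ
      obtain ⟨ih1, ih2⟩ := ih fun x hx => hQ (Finset.mem_insert_of_mem hx)
      have his : TorusIntegrable (fun y => 2 * Real.pi * Complex.I * res s *
          core a b (fun z => w z * link a b s z) y) 0 (R ∘ i.succAbove) :=
        (hint2 s (hQ (Finset.mem_insert_self s Q))).const_mul _
      simp only [Finset.sum_insert hsQ]
      refine ⟨his.add ih1, ?_⟩
      rw [torusIntegral_add his ih1, ih2, torusIntegral_const_mul]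
      rfl
  have hz : (0 : Fin (n + 1) → ℂ) ∘ i.succAbove = 0 := rfl
  rw [hz, torusIntegral_congr (c := 0) (R := R ∘ i.succAbove) (fun j => hR0 _) hinner,
    torusIntegral_add hint1 (hsum P subset_rfl).1,
    (hsum P subset_rfl).2]

theorem coreIntegral_radius_eq {a b : ℂ} {w : ℂ → ℂ} {N : ℕ} {m M : ℝ} (hm0 : 0 < m) (hmM : m ≤ M)
    (ha : ‖a‖ * M < m) (hb : ‖b‖ * M < m)
    (hw : ∀ z : ℂ, m ≤ ‖z‖ → ‖z‖ ≤ M → AnalyticAt ℂ w z) :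
    coreIntegral a b w (0 : Fin N → ℂ) (fun _ => M) =
      coreIntegral a b w (0 : Fin N → ℂ) fun _ => m := by
  have key : ∀ A : Finset (Fin N), coreIntegral a b w (0 : Fin N → ℂ) (fun _ => M) =
      coreIntegral a b w (0 : Fin N → ℂ) fun i => if i ∈ A then m else M := by
    intro A
    induction A using Finset.induction_on with
    | empty => simp
    | insert i A hi ih =>
      rw [ih]
      obtain ⟨n, rfl⟩ : ∃ n, N = n + 1 := ⟨N - 1, by have := i.pos; omega⟩
      have hc : ∀ ρ, m ≤ ρ → ρ ≤ M → ContinuousOn w (Metric.sphere 0 ρ) := fun ρ h1 h2 z hz => by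
        have : ‖z‖ = ρ := by simpa using hz
        exact (hw z (by linarith) (by linarith)).continuousAt.continuousWithinAt
      have hle : ∀ j, m ≤ (if j ∈ A then m else M) := fun j => by split_ifs <;> linarith
      have hle' : ∀ j, (if j ∈ A then m else M) ≤ M := fun j => by split_ifs <;> linarith
      rw [coreIntegral_shrink (w := w) (h := w) hm0 hle hle' ha hb i le_rfl (hle i)
        (fun j => hc _ (hle j) (hle' j)) (hc _ le_rfl hmM) ∅ 0 (by simp)
        (fun z h1 h2 => hw z h1 (h2.trans (hle' i))) (by simp) (by simp)]
      simp only [Finset.sum_empty, add_zero]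
      congr 1
      funext j
      rcases eq_or_ne j i with rfl | hj <;> simp [*]
  rw [key Finset.univ]
  simp

theorem crossFactor_mul {a b r : ℂ} (hr : r ≠ 0) (x y : ℂ) :
    crossFactor a b (r * x) (r * y) = crossFactor a b x y := by
  unfold crossFactor
  rw [show (r * y - r * x) * (r * y - a * b * (r * x)) =
      (r * r) * ((y - x) * (y - a * b * x)) by ring,
    show (r * y - a * (r * x)) * (r * y - b * (r * x)) =
      (r * r) * ((y - a * x) * (y - b * x)) by ring,
    mul_div_mul_left _ _ (mul_ne_zero hr hr)]

theorem core_scale {a b r : ℂ} (hr : r ≠ 0) (w : ℂ → ℂ) {N : ℕ} (z : Fin N → ℂ) :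
    core a b w (fun i => r * z i) = core a b (fun x => w (r * x)) z := by
  unfold core
  simp only [crossFactor_mul hr]

theorem coreIntegral_scale (a b : ℂ) (w : ℂ → ℂ) {N : ℕ} {r : ℝ} (hr : r ≠ 0) :
    coreIntegral a b w (0 : Fin N → ℂ) (fun _ => r) =
      (r : ℂ) ^ N * coreIntegral a b (fun x => w (r * x)) (0 : Fin N → ℂ) fun _ => 1 := by
  unfold coreIntegral
  rw [torusIntegral_zero_radius_eq]
  simp only [core_scale (Complex.ofReal_ne_zero.2 hr)]

/-- The pair factors are bounded on the unit torus. -/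
theorem exists_core_bound {a b : ℂ} (ha : ‖a‖ < 1) (hb : ‖b‖ < 1) (N : ℕ) :
    ∃ B : ℝ, 0 ≤ B ∧ ∀ (w : ℂ → ℂ) (C : ℝ), (∀ z : ℂ, ‖z‖ = 1 → ‖w z‖ ≤ C) →
      ∀ z : Fin N → ℂ, (∀ i, ‖z i‖ = 1) → ‖core a b w z‖ ≤ C ^ N * B := by
  have hsep : Separated a b (0 : Fin N → ℂ) (fun _ => (1 : ℝ)) :=
    separated_zero (m := 1) (M := 1) (fun _ => le_rfl) (fun _ => le_rfl) (by simpa) (by simpa)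
  have hc := core_continuousOn (w := fun _ => 1) hsep fun _ => continuousOn_const
  have hcomp : IsCompact {z : Fin N → ℂ | ∀ i, z i ∈ Metric.sphere ((0 : Fin N → ℂ) i) (1 : ℝ)} := by
    have := isCompact_univ_pi fun i : Fin N => isCompact_sphere ((0 : Fin N → ℂ) i) (1 : ℝ)
    simpa [Set.pi] using this
  obtain ⟨B, hB⟩ := hcomp.exists_bound_of_continuousOn hc
  refine ⟨max B 0, le_max_right _ _, fun w C hw z hz => ?_⟩
  have h1 := hB z fun i => by simpa using hz i
  have h2 : core a b w z = (∏ i, w (z i)) * core a b (fun _ => 1) z := by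
    unfold core; simp
  have h3 : ‖∏ i, w (z i)‖ ≤ C ^ N := by
    rw [norm_prod]
    refine (Finset.prod_le_prod (fun _ _ => norm_nonneg _) fun i _ => hw _ (hz i)).trans ?_
    simp
  rw [h2, norm_mul]
  exact mul_le_mul h3 (h1.trans (le_max_left _ _)) (norm_nonneg _) ((norm_nonneg _).trans h3)

theorem torusMap_zero_one_norm {N : ℕ} (θ : Fin N → ℝ) (i : Fin N) :
    ‖torusMap (0 : Fin N → ℂ) (fun _ => 1) θ i‖ = 1 := by
  have := torusMap_mem_sphere (0 : Fin N → ℂ) (R := fun _ => 1) (fun _ => zero_le_one) θ i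
  simpa using this

/-- If `w` has no poles in the disc `|z| ≤ t`, the integral vanishes: it does not change when the
torus is scaled down, and the pair factors are scale invariant. -/
theorem coreIntegral_eq_zero {a b : ℂ} (ha : ‖a‖ < 1) (hb : ‖b‖ < 1) {w : ℂ → ℂ} {N : ℕ}
    (hN : N ≠ 0) {t : ℝ} (ht : 0 < t) (hw : ∀ z : ℂ, ‖z‖ ≤ t → AnalyticAt ℂ w z) :
    coreIntegral a b w (0 : Fin N → ℂ) (fun _ => t) = 0 := by
  obtain ⟨q, hq1, hq2⟩ := exists_between (max_lt ha hb)
  have hq0 : 0 < q := ((norm_nonneg a).trans (le_max_left _ _)).trans_lt hq1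
  have hqa : ‖a‖ < q := (le_max_left _ _).trans_lt hq1
  have hqb : ‖b‖ < q := (le_max_right _ _).trans_lt hq1
  have hconst : ∀ n : ℕ, coreIntegral a b w (0 : Fin N → ℂ) (fun _ => t) =
      coreIntegral a b w (0 : Fin N → ℂ) (fun _ => q ^ n * t) := by
    intro n
    induction n with
    | zero => simp
    | succ n ih =>
      have hp : 0 < q ^ n * t := by positivity
      have hp' : q ^ n * t ≤ t := mul_le_of_le_one_left ht.le (pow_le_one₀ hq0.le hq2.le)
      rw [ih, coreIntegral_radius_eq (m := q ^ (n + 1) * t) (by positivity)]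
      · rw [pow_succ]; nlinarith
      · rw [pow_succ]; nlinarith
      · rw [pow_succ]; nlinarith
      · exact fun z _ hz => hw z (hz.trans hp')
  obtain ⟨B, hB0, hB⟩ := exists_core_bound ha hb N
  obtain ⟨C, hC⟩ := (isCompact_closedBall (0 : ℂ) t).exists_bound_of_continuousOn (f := w)
    fun z hz => (hw z (by simpa using hz)).continuousAt.continuousWithinAt
  set D : ℝ := (2 * Real.pi) ^ N * (C ^ N * B) with hD
  have hbound : ∀ n : ℕ, ‖coreIntegral a b w (0 : Fin N → ℂ) (fun _ => t)‖ ≤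
      (q ^ n * t) ^ N * D := by
    intro n
    have hp : 0 < q ^ n * t := by positivity
    have hp' : q ^ n * t ≤ t := mul_le_of_le_one_left ht.le (pow_le_one₀ hq0.le hq2.le)
    rw [hconst n, coreIntegral_scale _ _ _ hp.ne', norm_mul, norm_pow, Complex.norm_real,
      Real.norm_of_nonneg hp.le]
    gcongr
    have := norm_torusIntegral_le_of_norm_le_const (c := (0 : Fin N → ℂ)) (R := fun _ => 1)
      (f := core a b (fun x => w (((q ^ n * t : ℝ) : ℂ) * x))) (C := C ^ N * B) fun θ => by
        refine hB _ C (fun z hz => hC _ ?_) _ (torusMap_zero_one_norm θ)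
        simp only [Metric.mem_closedBall, dist_zero_right, norm_mul, Complex.norm_real, hz, mul_one]
        rwa [← norm_mul, Real.norm_of_nonneg hp.le]
    simpa [coreIntegral, hD] using this
  have hlim : Tendsto (fun n : ℕ => (q ^ n * t) ^ N * D) atTop (𝓝 0) := by
    have h1 := (tendsto_pow_atTop_nhds_zero_of_lt_one hq0.le hq2).mul_const t
    have h2 := (h1.pow N).mul_const D
    simpa [hN] using h2
  have := ge_of_tendsto' hlim hbound
  exact norm_le_zero_iff.1 this

/-- Shifting the simple pole of the one-variable factor inside the unit disc does not change the
integral: enlarging the torus is the same as moving the pole towards the origin. -/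
theorem coreIntegral_shift_pole {a b : ℂ} (ha : ‖a‖ < 1) (hb : ‖b‖ < 1) {u : ℂ} (hu : ‖u‖ < 1)
    (N : ℕ) : coreIntegral a b (fun z => 1 / (z - u)) (0 : Fin N → ℂ) (fun _ => 1) =
      coreIntegral a b (fun z => 1 / z) (0 : Fin N → ℂ) (fun _ => 1) := by
  obtain ⟨q, hq1, hq2⟩ := exists_between (max_lt ha hb)
  have hq0 : 0 < q := ((norm_nonneg a).trans (le_max_left _ _)).trans_lt hq1
  have hqa : ‖a‖ < q := (le_max_left _ _).trans_lt hq1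
  have hqb : ‖b‖ < q := (le_max_right _ _).trans_lt hq1
  have hstep : ∀ v : ℂ, ‖v‖ < 1 →
      coreIntegral a b (fun z => 1 / (z - v)) (0 : Fin N → ℂ) (fun _ => 1) =
      coreIntegral a b (fun z => 1 / (z - q * v)) (0 : Fin N → ℂ) (fun _ => 1) := by
    intro v hv
    have h1 := coreIntegral_radius_eq (N := N) (a := a) (b := b) (w := fun z => 1 / (z - v))
      (m := 1) (M := q⁻¹) one_pos (one_le_inv₀ hq0 |>.2 hq2.le)
      (by rw [← div_eq_mul_inv, div_lt_one hq0]; exact hqa)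
      (by rw [← div_eq_mul_inv, div_lt_one hq0]; exact hqb)
      fun z hz _ => AnalyticAt.div (by fun_prop) (by fun_prop) <| sub_ne_zero.2 <| by
        rintro rfl; linarith
    rw [← h1, coreIntegral_scale _ _ _ (inv_ne_zero hq0.ne')]
    have hqc : (q : ℂ) ≠ 0 := Complex.ofReal_ne_zero.2 hq0.ne'
    unfold coreIntegral
    rw [← torusIntegral_const_mul]
    congr 1
    funext z
    unfold core
    rw [← mul_assoc]
    congr 1
    have : ((q⁻¹ : ℝ) : ℂ) ^ N = ∏ _i : Fin N, ((q⁻¹ : ℝ) : ℂ) := by simp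
    rw [this, ← Finset.prod_mul_distrib]
    refine Finset.prod_congr rfl fun i _ => ?_
    simp only
    rw [show z i - q * v = q * (((q⁻¹ : ℝ) : ℂ) * z i - v) by
      push_cast; field_simp]
    push_cast
    rw [one_div, one_div, mul_inv]
  have hsmall : ∀ n : ℕ, ‖(q : ℂ) ^ n * u‖ ≤ ‖u‖ := by
    intro n
    rw [norm_mul, norm_pow, Complex.norm_real, Real.norm_of_nonneg hq0.le]
    exact mul_le_of_le_one_left (norm_nonneg _) (pow_le_one₀ hq0.le hq2.le)
  have hconst : ∀ n : ℕ, coreIntegral a b (fun z => 1 / (z - u)) (0 : Fin N → ℂ) (fun _ => 1) =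
      coreIntegral a b (fun z => 1 / (z - q ^ n * u)) (0 : Fin N → ℂ) (fun _ => 1) := by
    intro n
    induction n with
    | zero => simp
    | succ n ih =>
      rw [ih, hstep _ ((hsmall n).trans_lt hu)]
      simp only [pow_succ, mul_assoc, mul_left_comm]
  obtain ⟨B, hB0, hB⟩ := exists_core_bound ha hb N
  have hsep : Separated a b (0 : Fin N → ℂ) (fun _ => (1 : ℝ)) :=
    separated_zero (m := 1) (M := 1) (fun _ => le_rfl) (fun _ => le_rfl) (by simpa) (by simpa)
  have hne : ∀ n : ℕ, ∀ z : ℂ, ‖z‖ = 1 → z - q ^ n * u ≠ 0 := by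
    intro n z hz h0
    have := hsmall n
    rw [← sub_eq_zero.1 h0, hz] at this
    linarith
  have hlim : Tendsto (fun n : ℕ => coreIntegral a b (fun z => 1 / (z - q ^ n * u))
      (0 : Fin N → ℂ) (fun _ => 1)) atTop
      (𝓝 (coreIntegral a b (fun z => 1 / z) (0 : Fin N → ℂ) (fun _ => 1))) := by
    unfold coreIntegral torusIntegral
    refine tendsto_integral_of_dominated_convergence
      (fun _ => ((1 - ‖u‖)⁻¹) ^ N * B) ?_ ?_ ?_ ?_
    · intro n
      have := (core_torusIntegrable (a := a) (b := b) (w := fun z => 1 / (z - q ^ n * u))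
        (p := (0 : Fin N → ℂ)) (R := fun _ => (1 : ℝ)) (fun _ => zero_le_one) hsep
        fun i => ContinuousOn.div (by fun_prop) (by fun_prop) fun z hz =>
          hne n z (by simpa using hz)).function_integrable
      exact this.1
    · exact integrableOn_const (measure_Icc_lt_top.ne)
    · intro n
      refine Eventually.of_forall fun θ => ?_
      have hprod : ‖∏ i : Fin N, (((1 : ℝ) : ℂ) * Complex.exp (θ i * Complex.I) * Complex.I)‖ = 1 := by
        simp [norm_prod, Complex.norm_exp_ofReal_mul_I]
      rw [norm_smul, hprod, one_mul]
      refine hB _ _ (fun z hz => ?_) _ (torusMap_zero_one_norm θ)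
      rw [one_div, norm_inv]
      refine inv_anti₀ (by linarith) ?_
      have h1 := norm_sub_norm_le z (q ^ n * u)
      have h2 := hsmall n
      rw [hz] at h1
      linarith
    · refine Eventually.of_forall fun θ => ?_
      refine Tendsto.const_smul ?_ _
      unfold core
      refine Tendsto.mul_const _ ?_
      refine tendsto_finsetProd _ fun i _ => ?_
      refine Tendsto.div tendsto_const_nhds ?_ ?_
      · have h1 : Tendsto (fun n : ℕ => (q : ℂ) ^ n) atTop (𝓝 0) :=
          tendsto_pow_atTop_nhds_zero_of_norm_lt_one (by
            rw [Complex.norm_real, Real.norm_of_nonneg hq0.le]; exact hq2)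
        simpa using (tendsto_const_nhds (x := torusMap (0 : Fin N → ℂ) (fun _ => 1) θ i)).sub
          (h1.mul_const u)
      · rw [← norm_ne_zero_iff, torusMap_zero_one_norm]
        exact one_ne_zero
  exact tendsto_nhds_unique (tendsto_const_nhds.congr hconst) hlim

/-! ### Diagrams as finite sets of complex numbers -/

/-- The standing assumptions on the parameters and the seeds; by `inj` a point `u_l a^i b^j` with
`i, j ≥ 0` determines `l`, `i` and `j`. -/
structure IsGeneric {k : ℕ} (a b : ℂ) (u : Fin k → ℂ) : Prop where
  a_ne : a ≠ 0
  b_ne : b ≠ 0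
  a_lt : ‖a‖ < 1
  b_lt : ‖b‖ < 1
  u_ne : ∀ l, u l ≠ 0
  u_lt : ∀ l, ‖u l‖ < 1
  inj : ∀ (l l' : Fin k) (i j i' j' : ℕ), u l * a ^ i * b ^ j = u l' * a ^ i' * b ^ j' →
    l = l' ∧ i = i' ∧ j = j'

/-- The points `u_l a^i b^j` with `i, j ≥ 0`, that is, all possible positions of boxes. -/
def positions {k : ℕ} (a b : ℂ) (u : Fin k → ℂ) : Set ℂ :=
  {z | ∃ (l : Fin k) (i j : ℕ), z = u l * a ^ i * b ^ j}

/-- `S` is the set of the boxes of a tuple of Young diagrams. -/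
def IsDiagram {k : ℕ} (a b : ℂ) (u : Fin k → ℂ) (S : Finset ℂ) : Prop :=
  (∀ s ∈ S, s ∈ positions a b u) ∧
    ∀ x ∈ positions a b u, (a * x ∈ S → x ∈ S) ∧ (b * x ∈ S → x ∈ S)

/-- The box `q` can be added to the diagrams `S`. -/
def IsAddable {k : ℕ} (a b : ℂ) (u : Fin k → ℂ) (S : Finset ℂ) (q : ℂ) : Prop :=
  q ∈ positions a b u ∧ q ∉ S ∧ (∀ x ∈ positions a b u, q = a * x → x ∈ S) ∧
    ∀ x ∈ positions a b u, q = b * x → x ∈ S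

section Positions

variable {k : ℕ} {a b : ℂ} {u : Fin k → ℂ}

theorem IsGeneric.positions_ne (h : IsGeneric a b u) {x : ℂ} (hx : x ∈ positions a b u) :
    x ≠ 0 := by
  obtain ⟨l, i, j, rfl⟩ := hx
  exact mul_ne_zero (mul_ne_zero (h.u_ne l) (pow_ne_zero _ h.a_ne)) (pow_ne_zero _ h.b_ne)

theorem IsGeneric.positions_lt (h : IsGeneric a b u) {x : ℂ} (hx : x ∈ positions a b u) :
    ‖x‖ < 1 := by
  obtain ⟨l, i, j, rfl⟩ := hx
  rw [norm_mul, norm_mul, norm_pow, norm_pow, mul_assoc]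
  refine mul_lt_one_of_nonneg_of_lt_one_left (norm_nonneg _) (h.u_lt l) ?_
  exact mul_le_one₀ (pow_le_one₀ (norm_nonneg _) h.a_lt.le) (by positivity)
    (pow_le_one₀ (norm_nonneg _) h.b_lt.le)

theorem seed_mem_positions (l : Fin k) : u l ∈ positions a b u := ⟨l, 0, 0, by simp⟩

theorem mul_left_mem_positions {x : ℂ} (hx : x ∈ positions a b u) : a * x ∈ positions a b u := by
  obtain ⟨l, i, j, rfl⟩ := hx
  exact ⟨l, i + 1, j, by ring⟩

theorem mul_right_mem_positions {x : ℂ} (hx : x ∈ positions a b u) : b * x ∈ positions a b u := by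
  obtain ⟨l, i, j, rfl⟩ := hx
  exact ⟨l, i, j + 1, by ring⟩

theorem IsGeneric.seed_ne_left (h : IsGeneric a b u) (l : Fin k) {x : ℂ}
    (hx : x ∈ positions a b u) : u l ≠ a * x := by
  obtain ⟨l', i, j, rfl⟩ := hx
  intro he
  have := h.inj l l' 0 0 (i + 1) j (by simp [he]; ring)
  omega

theorem IsGeneric.seed_ne_right (h : IsGeneric a b u) (l : Fin k) {x : ℂ}
    (hx : x ∈ positions a b u) : u l ≠ b * x := by
  obtain ⟨l', i, j, rfl⟩ := hx
  intro he
  have := h.inj l l' 0 0 i (j + 1) (by simp [he]; ring)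
  omega

theorem IsGeneric.exists_common (h : IsGeneric a b u) {x y : ℂ} (hx : x ∈ positions a b u)
    (hy : y ∈ positions a b u) (hxy : a * x = b * y) :
    ∃ d ∈ positions a b u, x = b * d ∧ y = a * d := by
  obtain ⟨l, i, j, rfl⟩ := hx
  obtain ⟨l', i', j', rfl⟩ := hy
  obtain ⟨rfl, h1, h2⟩ := h.inj l l' (i + 1) j i' (j' + 1) (by linear_combination hxy)
  subst h1 h2
  exact ⟨u l * a ^ i * b ^ j', ⟨l, i, j', rfl⟩, by ring, by ring⟩

theorem positions_cases {q : ℂ} (hq : q ∈ positions a b u) :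
    (∃ l, q = u l) ∨ (∃ x ∈ positions a b u, q = a * x) ∨ ∃ x ∈ positions a b u, q = b * x := by
  obtain ⟨l, i, j, rfl⟩ := hq
  rcases i with _ | i
  · rcases j with _ | j
    · exact Or.inl ⟨l, by simp⟩
    · exact Or.inr (Or.inr ⟨u l * a ^ 0 * b ^ j, ⟨l, 0, j, rfl⟩, by ring⟩)
  · exact Or.inr (Or.inl ⟨u l * a ^ i * b ^ j, ⟨l, i, j, rfl⟩, by ring⟩)

theorem IsDiagram.insert {S : Finset ℂ} {q : ℂ} (hS : IsDiagram a b u S)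
    (hq : IsAddable a b u S q) : IsDiagram a b u (insert q S) := by
  obtain ⟨h1, -, h3, h4⟩ := hq
  refine ⟨fun s hs => ?_, fun x hx => ⟨fun hax => ?_, fun hbx => ?_⟩⟩
  · rcases Finset.mem_insert.1 hs with rfl | hs
    · exact h1
    · exact hS.1 s hs
  · refine Finset.mem_insert_of_mem ?_
    rcases Finset.mem_insert.1 hax with h | h
    · exact h3 x hx h.symm
    · exact (hS.2 x hx).1 h
  · refine Finset.mem_insert_of_mem ?_
    rcases Finset.mem_insert.1 hbx with h | h
    · exact h4 x hx h.symm
    · exact (hS.2 x hx).2 h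

open Classical in
/-- Counting the arrows into `q`, the arrow from a seed included, against the zeros at `q`: the
difference is `1` if `q` is an addable box of `S`, and never exceeds `0` otherwise. -/
theorem IsGeneric.order_count (h : IsGeneric a b u) {S : Finset ℂ} (hS : IsDiagram a b u S)
    (q : ℂ) :
    let n : ℤ := -(if ∃ l, q = u l then 1 else 0) - (if ∃ s ∈ S, q = a * s then 1 else 0)
      - (if ∃ s ∈ S, q = b * s then 1 else 0) + (if ∃ s ∈ S, q = a * b * s then 1 else 0)
      + 2 * (if q ∈ S then 1 else 0)
    (IsAddable a b u S q → n = -1) ∧ (¬ IsAddable a b u S q → 0 ≤ n) := by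
  intro n
  by_cases hq : q ∈ positions a b u
  swap
  · have e1 : ¬ ∃ l, q = u l := by rintro ⟨l, rfl⟩; exact hq (seed_mem_positions l)
    have e2 : ¬ ∃ s ∈ S, q = a * s := by
      rintro ⟨s, hs, rfl⟩; exact hq (mul_left_mem_positions (hS.1 s hs))
    have e3 : ¬ ∃ s ∈ S, q = b * s := by
      rintro ⟨s, hs, rfl⟩; exact hq (mul_right_mem_positions (hS.1 s hs))
    refine ⟨fun hA => absurd hA.1 hq, fun _ => ?_⟩
    simp only [n, e1, e2, e3, if_false]
    split_ifs <;> norm_num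
  have hA : (∃ s ∈ S, q = a * s) ↔ ∃ x ∈ positions a b u, q = a * x ∧ x ∈ S :=
    ⟨fun ⟨s, hs, e⟩ => ⟨s, hS.1 s hs, e, hs⟩, fun ⟨x, _, e, hx⟩ => ⟨x, hx, e⟩⟩
  have hB : (∃ s ∈ S, q = b * s) ↔ ∃ x ∈ positions a b u, q = b * x ∧ x ∈ S :=
    ⟨fun ⟨s, hs, e⟩ => ⟨s, hS.1 s hs, e, hs⟩, fun ⟨x, _, e, hx⟩ => ⟨x, hx, e⟩⟩
  -- The cases: `q` has a left neighbour and a lower one (hence also a diagonal one), only one of the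
  -- two, or is a seed.
  by_cases ha : ∃ x ∈ positions a b u, q = a * x
  · obtain ⟨x, hx, rfl⟩ := ha
    have e1 : ¬ ∃ l, a * x = u l := fun ⟨l, hl⟩ => h.seed_ne_left l hx hl.symm
    have eA : (∃ s ∈ S, a * x = a * s) ↔ x ∈ S := by
      simp [h.a_ne]
    by_cases hb : ∃ y ∈ positions a b u, a * x = b * y
    · obtain ⟨y, hy, hxy⟩ := hb
      obtain ⟨d, hd, rfl, rfl⟩ := h.exists_common hx hy hxy
      have eB : (∃ s ∈ S, a * (b * d) = b * s) ↔ a * d ∈ S := by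
        simp [hxy, h.b_ne]
      have eD : (∃ s ∈ S, a * (b * d) = a * b * s) ↔ d ∈ S := by
        simp [← mul_assoc, h.b_ne, h.a_ne]
      have eAdd : IsAddable a b u S (a * (b * d)) ↔
          a * (b * d) ∉ S ∧ b * d ∈ S ∧ a * d ∈ S := by
        unfold IsAddable
        constructor
        · rintro ⟨-, h2, h3, h4⟩
          exact ⟨h2, h3 _ hx rfl, h4 _ hy hxy⟩
        · rintro ⟨h2, h3, h4⟩
          refine ⟨hq, h2, fun z _ hz => ?_, fun z _ hz => ?_⟩
          · rwa [← mul_left_cancel₀ h.a_ne hz]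
          · rw [hxy] at hz
            rwa [← mul_left_cancel₀ h.b_ne hz]
      have i1 := (hS.2 _ hx).1
      have i2 := (hS.2 _ hy).2
      have i3 := (hS.2 _ hd).1
      have i4 := (hS.2 _ hd).2
      rw [← hxy] at i2
      simp only [n, e1, eA, eB, eD, eAdd]
      by_cases c1 : a * (b * d) ∈ S <;> by_cases c2 : b * d ∈ S <;> by_cases c3 : a * d ∈ S <;>
        by_cases c4 : d ∈ S <;> simp_all
    · have eB : ¬ ∃ s ∈ S, a * x = b * s := fun ⟨s, hs, e⟩ => hb ⟨s, hS.1 s hs, e⟩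
      have eD : ¬ ∃ s ∈ S, a * x = a * b * s := fun ⟨s, hs, e⟩ =>
        hb ⟨a * s, mul_left_mem_positions (hS.1 s hs), by rw [e]; ring⟩
      have eAdd : IsAddable a b u S (a * x) ↔ a * x ∉ S ∧ x ∈ S := by
        unfold IsAddable
        constructor
        · rintro ⟨-, h2, h3, h4⟩
          exact ⟨h2, h3 _ hx rfl⟩
        · rintro ⟨h2, h3⟩
          refine ⟨hq, h2, fun z _ hz => ?_, fun z hz' hz => (hb ⟨z, hz', hz⟩).elim⟩
          rwa [← mul_left_cancel₀ h.a_ne hz]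
      have i1 := (hS.2 _ hx).1
      simp only [n, e1, eA, eB, eD, eAdd]
      by_cases c1 : a * x ∈ S <;> by_cases c2 : x ∈ S <;> simp_all
  · have eA : ¬ ∃ s ∈ S, q = a * s := fun ⟨s, hs, e⟩ => ha ⟨s, hS.1 s hs, e⟩
    have eD : ¬ ∃ s ∈ S, q = a * b * s := fun ⟨s, hs, e⟩ =>
      ha ⟨b * s, mul_right_mem_positions (hS.1 s hs), by rw [e]; ring⟩
    by_cases hb : ∃ y ∈ positions a b u, q = b * y
    · obtain ⟨y, hy, rfl⟩ := hb
      have e1 : ¬ ∃ l, b * y = u l := fun ⟨l, hl⟩ => h.seed_ne_right l hy hl.symm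
      have eB : (∃ s ∈ S, b * y = b * s) ↔ y ∈ S := by
        simp [h.b_ne]
      have eAdd : IsAddable a b u S (b * y) ↔ b * y ∉ S ∧ y ∈ S := by
        unfold IsAddable
        constructor
        · rintro ⟨-, h2, h3, h4⟩
          exact ⟨h2, h4 _ hy rfl⟩
        · rintro ⟨h2, h3⟩
          refine ⟨hq, h2, fun z hz' hz => (ha ⟨z, hz', hz⟩).elim, fun z _ hz => ?_⟩
          rwa [← mul_left_cancel₀ h.b_ne hz]
      have i1 := (hS.2 _ hy).2
      simp only [n, e1, eA, eB, eD, eAdd]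
      by_cases c1 : b * y ∈ S <;> by_cases c2 : y ∈ S <;> simp_all
    · have e1 : ∃ l, q = u l := by
        rcases positions_cases hq with h1 | h1 | h1
        · exact h1
        · exact absurd h1 ha
        · exact absurd h1 hb
      have eB : ¬ ∃ s ∈ S, q = b * s := fun ⟨s, hs, e⟩ => hb ⟨s, hS.1 s hs, e⟩
      have eAdd : IsAddable a b u S q ↔ q ∉ S :=
        ⟨fun h => h.2.1, fun h2 => ⟨hq, h2, fun z hz' hz => (ha ⟨z, hz', hz⟩).elim,
          fun z hz' hz => (hb ⟨z, hz', hz⟩).elim⟩⟩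
      simp only [n, e1, eA, eB, eD, eAdd]
      by_cases c1 : q ∈ S <;> simp_all

end Positions

/-! ### Orders of the one-variable factors -/

/-- `f` is meromorphic at `q` of order `n`, where `n` is finite. -/
def HasOrder (f : ℂ → ℂ) (q : ℂ) (n : ℤ) : Prop :=
  MeromorphicAt f q ∧ meromorphicOrderAt f q = n

theorem HasOrder.mul {f g : ℂ → ℂ} {q : ℂ} {m n : ℤ} (hf : HasOrder f q m) (hg : HasOrder g q n) :
    HasOrder (fun z => f z * g z) q (m + n) :=
  ⟨hf.1.fun_mul hg.1, by
    refine (meromorphicOrderAt_mul hf.1 hg.1).trans ?_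
    rw [hf.2, hg.2]; norm_cast⟩

theorem HasOrder.div {f g : ℂ → ℂ} {q : ℂ} {m n : ℤ} (hf : HasOrder f q m) (hg : HasOrder g q n) :
    HasOrder (fun z => f z / g z) q (m - n) :=
  ⟨hf.1.fun_div hg.1, by
    refine (meromorphicOrderAt_div hf.1 hg.1).trans ?_
    rw [hf.2, hg.2]; norm_cast⟩

theorem HasOrder.prod {ι : Type*} (S : Finset ι) {f : ι → ℂ → ℂ} {q : ℂ} {m : ι → ℤ}
    (h : ∀ i ∈ S, HasOrder (f i) q (m i)) :
    HasOrder (fun z => ∏ i ∈ S, f i z) q (∑ i ∈ S, m i) := by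
  refine ⟨MeromorphicAt.fun_prod fun i hi => (h i hi).1, ?_⟩
  rw [meromorphicOrderAt_fun_prod fun i hi => (h i hi).1, Finset.sum_congr rfl fun i hi => (h i hi).2]
  norm_cast

theorem HasOrder.congr {f g : ℂ → ℂ} {q : ℂ} {n : ℤ} (hf : HasOrder f q n)
    (h : f =ᶠ[𝓝[≠] q] g) : HasOrder g q n :=
  ⟨hf.1.congr h, by rw [← meromorphicOrderAt_congr h, hf.2]⟩

theorem hasOrder_zero_of_analyticAt {f : ℂ → ℂ} {q : ℂ} (hf : AnalyticAt ℂ f q) (h : f q ≠ 0) :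
    HasOrder f q 0 :=
  ⟨hf.meromorphicAt, (meromorphicOrderAt_eq_int_iff hf.meromorphicAt).2 ⟨f, hf, h, by simp⟩⟩

open Classical in
theorem hasOrder_sub (c q : ℂ) : HasOrder (fun z => z - c) q (if q = c then 1 else 0) := by
  split_ifs with h
  · subst h
    exact ⟨by fun_prop, by simp⟩
  · exact hasOrder_zero_of_analyticAt (by fun_prop) (sub_ne_zero.2 h)

/-- A function of order at least `-1` is a simple pole times an analytic function. -/
theorem HasOrder.exists_simplePole {f : ℂ → ℂ} {q : ℂ} {n : ℤ} (hf : HasOrder f q n)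
    (hn : -1 ≤ n) : ∃ g, AnalyticAt ℂ g q ∧ (∀ᶠ z in 𝓝[≠] q, f z = (z - q)⁻¹ * g z) ∧
      (g q ≠ 0 ↔ n = -1) := by
  obtain ⟨g, hg, hg0, h⟩ := (meromorphicOrderAt_eq_int_iff hf.1).1 hf.2
  obtain ⟨m, rfl⟩ : ∃ m : ℕ, n = m - 1 := ⟨(n + 1).toNat, by omega⟩
  refine ⟨fun z => (z - q) ^ m * g z, by fun_prop, ?_, ?_⟩
  · filter_upwards [h, self_mem_nhdsWithin] with z hz hne
    have : z - q ≠ 0 := sub_ne_zero.2 hne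
    rw [hz, zpow_sub₀ this, smul_eq_mul]
    simp only [zpow_natCast, zpow_one]
    field_simp
  · rcases Nat.eq_zero_or_pos m with rfl | hm
    · simp [hg0]
    · simp [hm.ne']

/-- `w` has simple poles exactly at those seeds that lie in `D`, and no zeros in `D` except
possibly at the origin. -/
structure IsSeeded {k : ℕ} (u : Fin k → ℂ) (w : ℂ → ℂ) (D : Set ℂ) : Prop where
  regular : ∀ q ∈ D, q ≠ 0 → (∀ l, q ≠ u l) → AnalyticAt ℂ w q ∧ w q ≠ 0
  pole : ∀ l, u l ∈ D → HasOrder w (u l) (-1)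
  zero : ∃ n : ℤ, 0 ≤ n ∧ HasOrder w 0 n

/-- The one-variable factor that remains after variables have been integrated out by taking the
residues at the boxes of `S`. -/
noncomputable def dressed (a b : ℂ) (w : ℂ → ℂ) (S : Finset ℂ) (z : ℂ) : ℂ :=
  w z * ∏ s ∈ S, link a b s z

/-- The modulus of `q` is so small that neither `a q` nor `b q` can be a box of `S`. The poles of the
dressed factor at `s / a` and `s / b`, `s ∈ S`, then stay away from `q`. -/
def IsBelow (a b : ℂ) (S : Finset ℂ) (q : ℂ) : Prop :=
  ∀ s ∈ S, ‖a‖ * ‖q‖ < ‖s‖ ∧ ‖b‖ * ‖q‖ < ‖s‖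

theorem dressed_insert (a b : ℂ) (w : ℂ → ℂ) {S : Finset ℂ} {s : ℂ} (hs : s ∉ S) :
    dressed a b w (insert s S) = fun z => dressed a b w S z * link a b s z := by
  funext z
  unfold dressed
  rw [Finset.prod_insert hs]
  ring

open Classical in
theorem link_hasOrder {a b s q : ℂ} (ha1 : ‖a‖ < 1) (ha : ‖a‖ * ‖q‖ < ‖s‖)
    (hb : ‖b‖ * ‖q‖ < ‖s‖) : HasOrder (link a b s) q
      ((if q = s then 1 else 0) + (if q = a * b * s then 1 else 0)
        - ((if q = a * s then 1 else 0) + (if q = b * s then 1 else 0))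
        + (if q = s then 1 else 0)) := by
  have e1 : HasOrder (fun z => crossFactor a b s z) q
      ((if q = s then 1 else 0) + (if q = a * b * s then 1 else 0)
        - ((if q = a * s then 1 else 0) + (if q = b * s then 1 else 0))) :=
    ((hasOrder_sub s q).mul (hasOrder_sub (a * b * s) q)).div
      ((hasOrder_sub (a * s) q).mul (hasOrder_sub (b * s) q))
  have n1 : s - a * q ≠ 0 := by
    intro h0
    rw [sub_eq_zero] at h0
    rw [h0, norm_mul] at ha
    exact lt_irrefl _ ha
  have n2 : s - b * q ≠ 0 := by
    intro h0
    rw [sub_eq_zero] at h0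
    rw [h0, norm_mul] at hb
    exact lt_irrefl _ hb
  have n3 : s - a * b * q ≠ 0 := by
    intro h0
    rw [sub_eq_zero] at h0
    have : ‖s‖ = ‖a‖ * (‖b‖ * ‖q‖) := by rw [h0, norm_mul, norm_mul, mul_assoc]
    nlinarith [norm_nonneg b, norm_nonneg q, mul_nonneg (norm_nonneg b) (norm_nonneg q)]
  have hden : AnalyticAt ℂ (fun z => (s - a * z) * (s - b * z)) q := by fun_prop
  have e2 : HasOrder (fun z => -(s - a * b * z) / ((s - a * z) * (s - b * z))) q 0 :=
    hasOrder_zero_of_analyticAt (AnalyticAt.div (by fun_prop) hden (mul_ne_zero n1 n2))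
      (div_ne_zero (neg_ne_zero.2 n3) (mul_ne_zero n1 n2))
  have e3 := (hasOrder_sub s q).mul e2
  have e4 := e1.mul e3
  rw [add_zero] at e4
  refine e4.congr (Eventually.of_forall fun z => ?_)
  have : crossFactor a b z s =
      (z - s) * (-(s - a * b * z) / ((s - a * z) * (s - b * z))) := by
    unfold crossFactor
    rw [mul_div_assoc', ← neg_sub z s]
    congr 1
    ring
  simp only [link, this]

open Classical in
theorem sum_ite_mul_eq {c : ℂ} (hc : c ≠ 0) (S : Finset ℂ) (q : ℂ) :
    ∑ s ∈ S, (if q = c * s then (1 : ℤ) else 0) = if ∃ s ∈ S, q = c * s then 1 else 0 := by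
  have : ∀ s, (q = c * s) ↔ q / c = s := fun s => by rw [div_eq_iff hc, mul_comm]
  simp only [this, Finset.sum_ite_eq]
  simp

section Dressed

variable {k : ℕ} {a b : ℂ} {u : Fin k → ℂ} {w : ℂ → ℂ} {D : Set ℂ}

open Classical in
theorem IsSeeded.exists_order (hw : IsSeeded u w D) {q : ℂ} (hq : q ∈ D) :
    ∃ n : ℤ, HasOrder w q n ∧ -(if ∃ l, q = u l then 1 else 0) ≤ n ∧
      (q ≠ 0 → n = -(if ∃ l, q = u l then 1 else 0)) := by
  by_cases h : ∃ l, q = u l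
  · obtain ⟨l, rfl⟩ := h
    exact ⟨-1, hw.pole l hq, by simp, by simp⟩
  · simp only [h, if_false]
    rcases eq_or_ne q 0 with rfl | h0
    · obtain ⟨n, hn, h1⟩ := hw.zero
      exact ⟨n, h1, by simpa using hn, by simp⟩
    · obtain ⟨h1, h2⟩ := hw.regular q hq h0 fun l hl => h ⟨l, hl⟩
      exact ⟨0, hasOrder_zero_of_analyticAt h1 h2, by simp, by simp⟩

/-- The poles of the dressed factor are simple and sit at the addable boxes. -/
theorem IsSeeded.dressed_simplePole (hw : IsSeeded u w D) (h : IsGeneric a b u) {S : Finset ℂ}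
    (hS : IsDiagram a b u S) {q : ℂ} (hq : q ∈ D) (hb : IsBelow a b S q) :
    MeromorphicAt (dressed a b w S) q ∧
    ∃ g, AnalyticAt ℂ g q ∧ (∀ᶠ z in 𝓝[≠] q, dressed a b w S z = (z - q)⁻¹ * g z) ∧
      (g q ≠ 0 ↔ IsAddable a b u S q) := by
  classical
  obtain ⟨n, hn, hn1, hn2⟩ := hw.exists_order hq
  have hord := hn.mul (HasOrder.prod S fun s hs =>
    link_hasOrder h.a_lt (hb s hs).1 (hb s hs).2)
  obtain ⟨c1, c2⟩ := h.order_count hS q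
  have hab : a * b ≠ 0 := mul_ne_zero h.a_ne h.b_ne
  simp only [Finset.sum_add_distrib, Finset.sum_sub_distrib, sum_ite_mul_eq h.a_ne,
    sum_ite_mul_eq h.b_ne, sum_ite_mul_eq hab, Finset.sum_ite_eq] at hord
  set N : ℤ := n + ((((if q ∈ S then 1 else 0) + if ∃ s ∈ S, q = a * b * s then 1 else 0) -
      ((if ∃ s ∈ S, q = a * s then 1 else 0) + if ∃ s ∈ S, q = b * s then 1 else 0)) +
        if q ∈ S then 1 else 0) with hN
  have hadd : IsAddable a b u S q → N = -1 := by
    intro hA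
    have := c1 hA
    have := hn2 (h.positions_ne hA.1)
    rw [hN]
    linarith
  have hnadd : ¬ IsAddable a b u S q → 0 ≤ N := by
    intro hA
    have := c2 hA
    rw [hN]
    linarith
  obtain ⟨g, hg, hfg, hg0⟩ := hord.exists_simplePole (n := N) (by
    by_cases hA : IsAddable a b u S q
    · rw [hadd hA]
    · have := hnadd hA; omega)
  refine ⟨hord.1, g, hg, hfg, hg0.trans ⟨fun hm => ?_, hadd⟩⟩
  by_contra hA
  have := hnadd hA
  omega

end Dressed

/-! ### Contributions of single pole-tuples -/

/-- `c` is the integral of `core` over all sufficiently small tori around `p`. -/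
def HasCoreContribution (a b : ℂ) (w : ℂ → ℂ) {N : ℕ} (p : Fin N → ℂ) (c : ℂ) : Prop :=
  ∀ᶠ ε : ℝ in 𝓝[>] 0, coreIntegral a b w p (fun _ => ε) = c

theorem coreIntegral_fin_zero (a b : ℂ) (w : ℂ → ℂ) (p : Fin 0 → ℂ) (R : Fin 0 → ℝ) :
    coreIntegral a b w p R = 1 := by
  simp [coreIntegral, core]

theorem exists_principalPart {g : ℂ → ℂ} {q : ℂ} (hg : AnalyticAt ℂ g q) :
    ∃ g₁, AnalyticAt ℂ g₁ q ∧
      ∀ᶠ z in 𝓝[≠] q, (z - q)⁻¹ * g z = g₁ z + g q * (z - q)⁻¹ := by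
  refine ⟨dslope g q, ?_, ?_⟩
  · have h1 : {z | AnalyticAt ℂ g z} ∈ 𝓝 q := (isOpen_analyticAt ℂ g).mem_nhds hg
    refine DifferentiableOn.analyticAt (s := {z | AnalyticAt ℂ g z}) ?_ h1
    rw [Complex.differentiableOn_dslope h1]
    exact fun z hz => hz.differentiableAt.differentiableWithinAt
  · filter_upwards [self_mem_nhdsWithin] with z hz
    have hz : z ≠ q := hz
    rw [dslope_of_ne _ hz, slope_def_field]
    have : z - q ≠ 0 := sub_ne_zero.2 hz
    field_simp
    ring

/-- `f` has at most a simple pole at `q`, with residue `c`. -/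
def HasResidue (f : ℂ → ℂ) (q c : ℂ) : Prop :=
  ∃ g, AnalyticAt ℂ g q ∧ (∀ᶠ z in 𝓝[≠] q, f z = (z - q)⁻¹ * g z) ∧ g q = c

theorem HasResidue.exists_principalPart {f : ℂ → ℂ} {q c : ℂ} (h : HasResidue f q c) :
    ∃ g, AnalyticAt ℂ g q ∧ ∀ᶠ z in 𝓝[≠] q, f z = g z + c * (z - q)⁻¹ := by
  obtain ⟨g, hg, hfg, rfl⟩ := h
  obtain ⟨g₁, hg₁, h1⟩ := HallLittlewood.exists_principalPart hg
  refine ⟨g₁, hg₁, ?_⟩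
  filter_upwards [hfg, h1] with z h2 h3
  rw [h2, h3]

theorem HasCoreContribution.of_removeNth {a b : ℂ} (ha : ‖a‖ < 1) (hb : ‖b‖ < 1) {w : ℂ → ℂ}
    {n : ℕ} {p : Fin (n + 1) → ℂ} (i : Fin (n + 1))
    (hp : ∀ j, p i ≠ a * p (i.succAbove j) ∧ p i ≠ b * p (i.succAbove j))
    (hw : ∀ j, MeromorphicAt w (p j)) {r c : ℂ} (hr : HasResidue w (p i) r)
    (hc : HasCoreContribution a b (fun z => w z * link a b (p i) z) (p ∘ i.succAbove) c) :
    HasCoreContribution a b w p (2 * Real.pi * Complex.I * r * c) := by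
  obtain ⟨g, hg, hwg, rfl⟩ := hr
  filter_upwards [coreIntegral_small_step ha hb i hp hw hg hwg, hc] with ε h1 h2
  rw [h1, h2]

theorem HasCoreContribution.of_residue_zero {a b : ℂ} (ha : ‖a‖ < 1) (hb : ‖b‖ < 1) {w : ℂ → ℂ}
    {n : ℕ} {p : Fin (n + 1) → ℂ} (i : Fin (n + 1))
    (hp : ∀ j, p i ≠ a * p (i.succAbove j) ∧ p i ≠ b * p (i.succAbove j))
    (hw : ∀ j, MeromorphicAt w (p j)) (hr : HasResidue w (p i) 0) :
    HasCoreContribution a b w p 0 := by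
  obtain ⟨g, hg, hwg, h0⟩ := hr
  filter_upwards [coreIntegral_small_step ha hb i hp hw hg hwg] with ε h1
  rw [h1, h0]
  ring

theorem hasCoreContribution_zero {a b : ℂ} (ha : ‖a‖ < 1) (hb : ‖b‖ < 1) {w : ℂ → ℂ} {N : ℕ}
    (hN : N ≠ 0) (hr : HasResidue w 0 0) : HasCoreContribution a b w (0 : Fin N → ℂ) 0 := by
  obtain ⟨g, hg, hwg⟩ := hr.exists_principalPart
  filter_upwards [eventually_closedBall_of_punctured hwg,
    eventually_closedBall_of_nhds hg.eventually_analyticAt, self_mem_nhdsWithin] with ε h1 h2 h3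
  have h3 : 0 < ε := h3
  rw [coreIntegral_congr (w' := g) (fun _ => h3.le), coreIntegral_eq_zero ha hb hN h3]
  · exact fun z hz => h2 z (by simpa using hz)
  · intro i z hz
    have := h1 z (Metric.sphere_subset_closedBall hz) (Metric.ne_of_mem_sphere hz h3.ne')
    simpa using this

section Local

variable {k : ℕ} {a b : ℂ} {u : Fin k → ℂ} {w : ℂ → ℂ} {D : Set ℂ}

theorem IsSeeded.exists_residue (hw : IsSeeded u w D) (h : IsGeneric a b u) {S : Finset ℂ}
    (hS : IsDiagram a b u S) {q : ℂ} (hq : q ∈ D) (hb : IsBelow a b S q) :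
    ∃ r, HasResidue (dressed a b w S) q r ∧ (r ≠ 0 ↔ IsAddable a b u S q) := by
  obtain ⟨-, g, hg, h1, h2⟩ := hw.dressed_simplePole h hS hq hb
  exact ⟨g q, ⟨g, hg, h1, rfl⟩, h2⟩

theorem union_image_univ {n : ℕ} (S : Finset ℂ) (p : Fin (n + 1) → ℂ) (i : Fin (n + 1)) :
    S ∪ Finset.univ.image p = insert (p i) S ∪ Finset.univ.image (p ∘ i.succAbove) := by
  ext x
  simp only [Finset.mem_union, Finset.mem_image, Finset.mem_univ, true_and, Finset.mem_insert,
    comp_apply, i.exists_iff_succAbove]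
  tauto

/-- Variables are integrated out in the order of decreasing modulus of their centres. Each of them
either sits at an addable box of the diagram formed by its predecessors, and leaves a nonzero
residue, or makes the integral vanish. Hence a tuple contributes exactly if its entries are distinct
and form, together with `S`, a diagram. -/
theorem IsSeeded.exists_contribution (hw : IsSeeded u w D) (h : IsGeneric a b u) :
    ∀ (N : ℕ) (S : Finset ℂ) (p : Fin N → ℂ), IsDiagram a b u S → (∀ i, p i ∈ D) →
      (∀ i, IsBelow a b S (p i)) → ∃ c, HasCoreContribution a b (dressed a b w S) p c ∧
        (c ≠ 0 ↔ Injective p ∧ (∀ i, p i ∉ S) ∧ IsDiagram a b u (S ∪ Finset.univ.image p)) := by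
  intro N
  induction N with
  | zero =>
    intro S p hS _ _
    refine ⟨1, Eventually.of_forall fun ε => coreIntegral_fin_zero _ _ _ _ _, ?_⟩
    simp [hS, Function.injective_of_subsingleton]
  | succ n ih =>
    intro S p hS hD hbel
    obtain ⟨i, hi⟩ := Finite.exists_max fun i => ‖p i‖
    have hmer : ∀ j, MeromorphicAt (dressed a b w S) (p j) := fun j =>
      (hw.dressed_simplePole h hS (hD j) (hbel j)).1
    obtain ⟨r, hr, hr0⟩ := hw.exists_residue h hS (hD i) (hbel i)
    rcases eq_or_ne (p i) 0 with h0 | h0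
    · -- The modulus of `p i` is maximal, so all entries are `0`.
      have hp0 : p = 0 := by
        funext j
        have := hi j
        rw [h0, norm_zero] at this
        exact norm_le_zero_iff.1 this
      have hnadd : ¬ IsAddable a b u S (p i) := fun hA => h.positions_ne hA.1 h0
      have hrz : r = 0 := by
        by_contra hne
        exact hnadd (hr0.1 hne)
      refine ⟨0, ?_, ?_⟩
      · rw [hp0]
        refine hasCoreContribution_zero h.a_lt h.b_lt (Nat.succ_ne_zero n) ?_
        rw [h0, hrz] at hr
        exact hr
      · refine ⟨fun hne => (hne rfl).elim, fun hR => ?_⟩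
        exact (h.positions_ne (hR.2.2.1 (p i) (by simp)) h0).elim
    · have hpos : 0 < ‖p i‖ := norm_pos_iff.2 h0
      have hlt : ∀ c : ℂ, ‖c‖ < 1 → ∀ j, ‖c‖ * ‖p j‖ < ‖p i‖ := fun c hc j => by
        nlinarith [hi j, norm_nonneg (p j), norm_nonneg c]
      have hne : ∀ c : ℂ, ‖c‖ < 1 → ∀ j, p i ≠ c * p j := fun c hc j he => by
        have := hlt c hc j
        rw [← norm_mul, ← he] at this
        exact lt_irrefl _ this
      have hparr : ∀ j, p i ≠ a * p (i.succAbove j) ∧ p i ≠ b * p (i.succAbove j) :=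
        fun j => ⟨hne a h.a_lt _, hne b h.b_lt _⟩
      by_cases hA : IsAddable a b u S (p i)
      · -- A nonzero residue: `p i` becomes a box, and the remaining entries see `insert (p i) S`.
        obtain ⟨c, hc, hc0⟩ := ih (insert (p i) S) (p ∘ i.succAbove) (hS.insert hA)
          (fun j => hD _) (fun j s hs => by
            rcases Finset.mem_insert.1 hs with rfl | hs
            · exact ⟨hlt a h.a_lt _, hlt b h.b_lt _⟩
            · exact hbel _ s hs)
        rw [dressed_insert _ _ _ hA.2.1] at hc
        refine ⟨_, hc.of_removeNth h.a_lt h.b_lt i hparr hmer hr, ?_⟩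
        have hpi : (2 * Real.pi * Complex.I : ℂ) ≠ 0 := Complex.two_pi_I_ne_zero
        have e1 : 2 * Real.pi * Complex.I * r * c ≠ 0 ↔ c ≠ 0 := by
          simp [hpi, hr0.2 hA]
        rw [e1, hc0, union_image_univ S p i]
        constructor
        · rintro ⟨h1, h2, h3⟩
          refine ⟨?_, ?_, h3⟩
          · intro x y
            refine Fin.succAboveCases i ?_ (fun x => ?_) x <;>
              refine Fin.succAboveCases i ?_ (fun y => ?_) y
            · simp
            · intro he
              exact (h2 y (by simp [← he])).elim
            · intro he
              exact (h2 x (by simp [he])).elim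
            · intro he
              rw [h1 he]
          · intro j
            refine Fin.succAboveCases i hA.2.1 (fun j => ?_) j
            exact fun hj => h2 j (Finset.mem_insert_of_mem hj)
        · rintro ⟨h1, h2, h3⟩
          refine ⟨h1.comp Fin.succAbove_right_injective, fun j hj => ?_, h3⟩
          rcases Finset.mem_insert.1 hj with hj | hj
          · exact Fin.succAbove_ne i j (h1 hj)
          · exact h2 _ hj
      · have hrz : r = 0 := by
          by_contra hne
          exact hA (hr0.1 hne)
        rw [hrz] at hr
        -- The entries preceding `p i` in the two directions would have larger modulus, so they are
        -- not entries of `p`: a diagram `S ∪ range p` would make `p i` addable to `S`.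
        refine ⟨0, HasCoreContribution.of_residue_zero h.a_lt h.b_lt i hparr hmer hr, ?_⟩
        refine ⟨fun hne => (hne rfl).elim, fun ⟨_, h2, h3⟩ => ?_⟩
        refine (hA ⟨h3.1 _ (by simp), h2 i, fun x hx he => ?_, fun x hx he => ?_⟩).elim
        · have := (h3.2 x hx).1 (by rw [← he]; simp)
          rcases Finset.mem_union.1 this with hx | hx
          · exact hx
          · obtain ⟨j, -, rfl⟩ := Finset.mem_image.1 hx
            exact (hne a h.a_lt j he).elim
        · have := (h3.2 x hx).2 (by rw [← he]; simp)
          rcases Finset.mem_union.1 this with hx | hx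
          · exact hx
          · obtain ⟨j, -, rfl⟩ := Finset.mem_image.1 hx
            exact (hne b h.b_lt j he).elim

end Local

/-! ### The integral over the unit torus as a sum of contributions -/

/-- The common value of the integrals of `core` over small tori around `p`; the limit is a junk value
unless `HasCoreContribution` holds for some number. -/
noncomputable def contribution (a b : ℂ) (w : ℂ → ℂ) {N : ℕ} (p : Fin N → ℂ) : ℂ :=
  limUnder (𝓝[>] (0 : ℝ)) fun ε => coreIntegral a b w p fun _ => ε

theorem HasCoreContribution.contribution_eq {a b : ℂ} {w : ℂ → ℂ} {N : ℕ} {p : Fin N → ℂ} {c : ℂ}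
    (h : HasCoreContribution a b w p c) : contribution a b w p = c :=
  Tendsto.limUnder_eq (tendsto_nhds_of_eventually_eq h)

/-- Summation over tuples, one entry at a time. -/
theorem sum_piFinset_succAbove {n : ℕ} (i : Fin (n + 1)) (F : Fin (n + 1) → Finset ℂ)
    (f : (Fin (n + 1) → ℂ) → ℂ) :
    ∑ p ∈ Fintype.piFinset F, f p =
      ∑ x ∈ F i, ∑ p ∈ Fintype.piFinset (F ∘ i.succAbove), f (i.insertNth x p) := by
  rw [← Finset.sum_product']
  refine Finset.sum_nbij' (fun p => (p i, p ∘ i.succAbove)) (fun q => i.insertNth q.1 q.2)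
    ?_ ?_ ?_ ?_ ?_
  · intro p hp
    rw [Fintype.mem_piFinset] at hp
    simp [hp]
  · rintro ⟨x, p⟩ hq
    simp only [Finset.mem_product, Fintype.mem_piFinset] at hq
    rw [Fintype.mem_piFinset]
    intro j
    refine Fin.succAboveCases i ?_ (fun j => ?_) j
    · simpa using hq.1
    · simpa using hq.2 j
  · intro p _
    exact Fin.insertNth_self_removeNth i p
  · rintro ⟨x, p⟩ _
    simp [comp_def]
  · intro p _
    exact congrArg f (Fin.insertNth_self_removeNth i p).symm

/-- The positions `u_l a^i b^j` with `i + j < m`. -/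
noncomputable def boxes {k : ℕ} (a b : ℂ) (u : Fin k → ℂ) (m : ℕ) : Finset ℂ :=
  ((Finset.univ ×ˢ Finset.range m ×ˢ Finset.range m).filter
    fun t : Fin k × ℕ × ℕ => t.2.1 + t.2.2 < m).image fun t => u t.1 * a ^ t.2.1 * b ^ t.2.2

section Global

variable {k : ℕ} {a b : ℂ} {u : Fin k → ℂ} {w : ℂ → ℂ} {D : Set ℂ}

theorem mem_boxes {m : ℕ} {x : ℂ} :
    x ∈ boxes a b u m ↔ ∃ l i j, i + j < m ∧ x = u l * a ^ i * b ^ j := by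
  unfold boxes
  simp only [Finset.mem_image, Finset.mem_filter, Finset.mem_product, Finset.mem_univ, true_and,
    Finset.mem_range, Prod.exists]
  constructor
  · rintro ⟨l, i, j, ⟨-, h⟩, rfl⟩
    exact ⟨l, i, j, h, rfl⟩
  · rintro ⟨l, i, j, h, rfl⟩
    exact ⟨l, i, j, ⟨⟨by omega, by omega⟩, h⟩, rfl⟩

theorem boxes_subset_positions {m : ℕ} {x : ℂ} (hx : x ∈ boxes a b u m) :
    x ∈ positions a b u := by
  obtain ⟨l, i, j, -, rfl⟩ := mem_boxes.1 hx
  exact ⟨l, i, j, rfl⟩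

theorem boxes_mono {m m' : ℕ} (h : m ≤ m') : boxes a b u m ⊆ boxes a b u m' := fun x hx => by
  obtain ⟨l, i, j, hij, rfl⟩ := mem_boxes.1 hx
  exact mem_boxes.2 ⟨l, i, j, hij.trans_le h, rfl⟩

theorem IsAddable.mem_boxes {S : Finset ℂ} {m : ℕ} {q : ℂ} (hq : IsAddable a b u S q)
    (hS : S ⊆ boxes a b u m) : q ∈ boxes a b u (m + 1) := by
  rcases positions_cases hq.1 with ⟨l, rfl⟩ | ⟨x, hx, rfl⟩ | ⟨x, hx, rfl⟩
  · exact HallLittlewood.mem_boxes.2 ⟨l, 0, 0, by omega, by simp⟩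
  · obtain ⟨l, i, j, hij, rfl⟩ := HallLittlewood.mem_boxes.1 (hS (hq.2.2.1 x hx rfl))
    exact HallLittlewood.mem_boxes.2 ⟨l, i + 1, j, by omega, by ring⟩
  · obtain ⟨l, i, j, hij, rfl⟩ := HallLittlewood.mem_boxes.1 (hS (hq.2.2.2 x hx rfl))
    exact HallLittlewood.mem_boxes.2 ⟨l, i, j + 1, by omega, by ring⟩

theorem IsSeeded.dressed_analyticAt (hw : IsSeeded u w D) {S : Finset ℂ} (hS : IsDiagram a b u S)
    {q : ℂ} (hq : q ∈ D) (hq0 : q ≠ 0) (hqp : q ∉ positions a b u) (hb : IsBelow a b S q) :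
    AnalyticAt ℂ (dressed a b w S) q := by
  refine (hw.regular q hq hq0 ?_).1.mul (Finset.analyticAt_fun_prod _ fun s hs => ?_)
  · rintro l rfl
    exact hqp (seed_mem_positions l)
  · have e : link a b s = fun z => link a b z s := funext fun z => link_comm a b s z
    rw [e]
    have hb := hb s hs
    refine link_analyticAt ?_ ?_ ?_ ?_
    · intro he
      rw [he, norm_mul] at hb
      exact lt_irrefl _ hb.1
    · intro he
      rw [he, norm_mul] at hb
      exact lt_irrefl _ hb.2
    · rintro rfl
      exact hqp (mul_left_mem_positions (hS.1 s hs))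
    · rintro rfl
      exact hqp (mul_right_mem_positions (hS.1 s hs))

/-- A ratio `τ < 1` so close to `1` that successive radii `τ ^ n` keep the pair factors regular, and
such that no circle `|z| = τ ^ n` passes through a box position. -/
theorem IsGeneric.exists_ratio (h : IsGeneric a b u) :
    ∃ τ : ℝ, 0 < τ ∧ τ < 1 ∧ ‖a‖ < τ ∧ ‖b‖ < τ ∧
      ∀ n : ℕ, ∀ x ∈ positions a b u, ‖x‖ ≠ τ ^ n := by
  have hcount : (positions a b u).Countable := by
    have : positions a b u ⊆ range fun t : Fin k × ℕ × ℕ => u t.1 * a ^ t.2.1 * b ^ t.2.2 := by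
      rintro x ⟨l, i, j, rfl⟩
      exact ⟨(l, i, j), rfl⟩
    exact (countable_range _).mono this
  have hbad : (⋃ n : ℕ, {τ : ℝ | 0 < τ ∧ n ≠ 0 ∧ τ ^ n ∈ norm '' positions a b u}).Countable := by
    refine countable_iUnion fun n => ?_
    refine MapsTo.countable_of_injOn (f := fun τ : ℝ => τ ^ n)
      (t := norm '' positions a b u) (fun τ hτ => hτ.2.2) ?_ (hcount.image _)
    intro x hx y hy hxy
    exact (pow_left_inj₀ hx.1.le hy.1.le hx.2.1).1 hxy
  obtain ⟨τ, hτ, h1, h2⟩ := (hbad.dense_compl ℝ).exists_between (max_lt h.a_lt h.b_lt)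
  have hτ0 : 0 < τ := ((norm_nonneg a).trans (le_max_left _ _)).trans_lt h1
  refine ⟨τ, hτ0, h2, (le_max_left _ _).trans_lt h1, (le_max_right _ _).trans_lt h1, ?_⟩
  intro n x hx he
  rcases Nat.eq_zero_or_pos n with rfl | hn
  · have := h.positions_lt hx
    rw [he] at this
    simp at this
  · exact hτ (mem_iUnion.2 ⟨n, hτ0, hn.ne', x, hx, he⟩)

/-- The sum of the contributions of the tuples of boxes with `|p_i| < R_i`. -/
noncomputable def contributionSum {k : ℕ} (a b : ℂ) (u : Fin k → ℂ) (w : ℂ → ℂ) (M : ℕ)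
    (S : Finset ℂ) {N : ℕ} (R : Fin N → ℝ) : ℂ :=
  ∑ p ∈ Fintype.piFinset fun i => (boxes a b u M).filter fun x => ‖x‖ < R i,
    contribution a b (dressed a b w S) p

/-- The principal parts of the dressed factor in an annulus around the origin. -/
theorem IsSeeded.exists_principalParts (hw : IsSeeded u w D) (h : IsGeneric a b u)
    {S : Finset ℂ} (hS : IsDiagram a b u S) {r R : ℝ}
    (hr : 0 < r) (hD : ∀ z : ℂ, ‖z‖ ≤ R → z ∈ D) (hbel : ∀ z : ℂ, ‖z‖ ≤ R → IsBelow a b S z)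
    (hpr : ∀ x ∈ positions a b u, ‖x‖ ≠ r) (hpR : ∀ x ∈ positions a b u, ‖x‖ ≠ R)
    (P : Finset ℂ) (hP : ∀ s, s ∈ P ↔ r < ‖s‖ ∧ ‖s‖ < R ∧ IsAddable a b u S s) :
    ∃ res g : ℂ → ℂ,
      (∀ q : ℂ, r ≤ ‖q‖ → ‖q‖ ≤ R → HasResidue (dressed a b w S) q (res q) ∧
        (res q ≠ 0 ↔ IsAddable a b u S q)) ∧
      (∀ z : ℂ, r ≤ ‖z‖ → ‖z‖ ≤ R → AnalyticAt ℂ g z) ∧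
      ∀ z : ℂ, r ≤ ‖z‖ → ‖z‖ ≤ R → z ∉ positions a b u →
        dressed a b w S z = g z + ∑ s ∈ P, res s * (z - s)⁻¹ := by
  have hres : ∀ q : ℂ, ∃ c, r ≤ ‖q‖ ∧ ‖q‖ ≤ R → HasResidue (dressed a b w S) q c ∧
      (c ≠ 0 ↔ IsAddable a b u S q) := by
    intro q
    by_cases hq : r ≤ ‖q‖ ∧ ‖q‖ ≤ R
    · obtain ⟨c, hc⟩ := hw.exists_residue h hS (hD q hq.2) (hbel q hq.2)
      exact ⟨c, fun _ => hc⟩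
    · exact ⟨0, fun h => (hq h).elim⟩
  choose res hres using hres
  have han : ∀ (Q : Finset ℂ) (z : ℂ), z ∉ Q →
      AnalyticAt ℂ (fun z => ∑ s ∈ Q, res s * (z - s)⁻¹) z := by
    intro Q z hz
    refine Finset.analyticAt_fun_sum _ fun s hs => analyticAt_const.mul
      (AnalyticAt.inv (by fun_prop) (sub_ne_zero.2 ?_))
    rintro rfl
    exact hz hs
  obtain ⟨g, hg, hfg⟩ := exists_analyticAt_extension
    (f := fun z => dressed a b w S z - ∑ s ∈ P, res s * (z - s)⁻¹)
    (K := {z | r ≤ ‖z‖ ∧ ‖z‖ ≤ R}) (by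
      intro q hq
      obtain ⟨hr1, hr2⟩ := hres q hq
      obtain ⟨g, hg, hfg⟩ := hr1.exists_principalPart
      refine ⟨fun z => g z - ∑ s ∈ P.erase q, res s * (z - s)⁻¹,
        hg.sub (han _ _ (Finset.notMem_erase q P)), ?_⟩
      filter_upwards [hfg] with z hz
      by_cases hqP : q ∈ P
      · rw [hz, ← Finset.add_sum_erase P _ hqP]
        ring
      · have h0 : res q = 0 := by
          by_contra hne
          have hA := hr2.1 hne
          exact hqP ((hP q).2 ⟨lt_of_le_of_ne hq.1 (hpr q hA.1).symm,
            lt_of_le_of_ne hq.2 (hpR q hA.1), hA⟩)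
        rw [hz, h0, Finset.erase_eq_of_notMem hqP]
        ring)
  refine ⟨res, g, fun q h1 h2 => hres q ⟨h1, h2⟩, fun z h1 h2 => hg z ⟨h1, h2⟩, ?_⟩
  intro z h1 h2 hz
  have hzP : z ∉ P := fun hzP => hz ((hP z).1 hzP).2.2.1
  have hz0 : z ≠ 0 := by
    rintro rfl
    rw [norm_zero] at h1
    linarith
  have e := eq_of_eventuallyEq_punctured
    ((hw.dressed_analyticAt hS (hD z h2) hz0 hz (hbel z h2)).sub (han P z hzP)).continuousAt
    (hg z ⟨h1, h2⟩).continuousAt (hfg z ⟨h1, h2⟩)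
  simp only [Pi.sub_apply] at e
  rw [← e]
  ring

/-- If all boxes lie outside the torus, the integral vanishes. -/
theorem IsSeeded.coreIntegral_eq_zero_of_lt (hw : IsSeeded u w D) (h : IsGeneric a b u)
    {S : Finset ℂ} (hS : IsDiagram a b u S) {t : ℝ} (ht : 0 < t) (hD : ∀ z : ℂ, ‖z‖ ≤ t → z ∈ D)
    (hbel : ∀ z : ℂ, ‖z‖ ≤ t → IsBelow a b S z) (hadd : ∀ q, IsAddable a b u S q → t < ‖q‖)
    (hp : ∀ x ∈ positions a b u, ‖x‖ ≠ t) {N : ℕ} (hN : N ≠ 0) :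
    coreIntegral a b (dressed a b w S) (0 : Fin N → ℂ) (fun _ => t) = 0 := by
  obtain ⟨g, hg, hfg⟩ := exists_analyticAt_extension (f := dressed a b w S)
    (K := {z | ‖z‖ ≤ t}) (by
      intro q hq
      obtain ⟨r, hr, hr0⟩ := hw.exists_residue h hS (hD q hq) (hbel q hq)
      have h0 : r = 0 := by
        by_contra hne
        have := hadd q (hr0.1 hne)
        have hq : ‖q‖ ≤ t := hq
        linarith
      obtain ⟨g, hg, hfg⟩ := hr.exists_principalPart
      refine ⟨g, hg, ?_⟩
      filter_upwards [hfg] with z hz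
      rw [hz, h0]
      ring)
  rw [coreIntegral_congr (w' := g) (fun _ => ht.le),
    coreIntegral_eq_zero h.a_lt h.b_lt hN ht hg]
  intro i z hz
  have hz : ‖z‖ = t := by simpa using hz
  have hz0 : z ≠ 0 := by
    rintro rfl
    rw [norm_zero] at hz
    linarith
  exact eq_of_eventuallyEq_punctured
    (hw.dressed_analyticAt hS (hD z hz.le) hz0 (fun hzp => hp z hzp hz)
      (hbel z hz.le)).continuousAt (hg z hz.le).continuousAt (hfg z hz.le)

/-- The radii `τ ^ n` for the variables in `A` and `τ ^ (n + 1)` for the others. -/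
noncomputable def stepRadii (τ : ℝ) (n : ℕ) {N : ℕ} (A : Finset (Fin N)) (i : Fin N) : ℝ :=
  if i ∈ A then τ ^ n else τ ^ (n + 1)

theorem stepRadii_bounds {τ : ℝ} (h0 : 0 < τ) (h1 : τ < 1) (n : ℕ) {N : ℕ} (A : Finset (Fin N))
    (i : Fin N) : τ ^ (n + 1) ≤ stepRadii τ n A i ∧ stepRadii τ n A i ≤ τ ^ n := by
  have : τ ^ (n + 1) ≤ τ ^ n := pow_le_pow_of_le_one h0.le h1.le (Nat.le_succ n)
  unfold stepRadii
  split_ifs <;> constructor <;> linarith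

/-- Shrinking one circle from radius `τ ^ n` to radius `τ ^ (n + 1)`: the residues in the annulus
match the contributions of the tuples whose corresponding entry lies in the annulus. -/
theorem IsSeeded.coreIntegral_insert (hw : IsSeeded u w D) (h : IsGeneric a b u)
    (hD : Metric.closedBall 0 1 ⊆ D) {τ : ℝ} (hτ0 : 0 < τ) (hτ1 : τ < 1) (haτ : ‖a‖ < τ)
    (hbτ : ‖b‖ < τ) (hτ : ∀ n : ℕ, ∀ x ∈ positions a b u, ‖x‖ ≠ τ ^ n) {N M : ℕ}
    (ih : ∀ (n m : ℕ) (S : Finset ℂ) (A : Finset (Fin N)), IsDiagram a b u S →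
      S ⊆ boxes a b u m → m + N ≤ M → (∀ z : ℂ, ‖z‖ ≤ τ ^ n → IsBelow a b S z) →
      coreIntegral a b (dressed a b w S) 0 (stepRadii τ n A) =
        contributionSum a b u w M S (stepRadii τ n A))
    {n m : ℕ} {S : Finset ℂ} (hS : IsDiagram a b u S) (hSm : S ⊆ boxes a b u m)
    (hmM : m + (N + 1) ≤ M) (hbel : ∀ z : ℂ, ‖z‖ ≤ τ ^ n → IsBelow a b S z)
    {A : Finset (Fin (N + 1))} {i : Fin (N + 1)} (hi : i ∉ A)
    (hA : coreIntegral a b (dressed a b w S) 0 (stepRadii τ n A) =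
        contributionSum a b u w M S (stepRadii τ n A)) :
    coreIntegral a b (dressed a b w S) 0 (stepRadii τ n (insert i A)) =
        contributionSum a b u w M S (stepRadii τ n (insert i A)) := by
  classical
  set t : ℝ := τ ^ n with ht
  set t' : ℝ := τ ^ (n + 1) with ht'
  have htt : t' = τ * t := by rw [ht', ht, pow_succ]; ring
  have ht0 : 0 < t := pow_pos hτ0 n
  have ht'0 : 0 < t' := pow_pos hτ0 (n + 1)
  have ht1 : t ≤ 1 := pow_le_one₀ hτ0.le hτ1.le
  have htlt : t' < t := by rw [htt]; nlinarith
  have hat : ‖a‖ * t < t' := by rw [htt]; exact mul_lt_mul_of_pos_right haτ ht0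
  have hbt : ‖b‖ * t < t' := by rw [htt]; exact mul_lt_mul_of_pos_right hbτ ht0
  have hDt : ∀ z : ℂ, ‖z‖ ≤ t → z ∈ D := fun z hz => hD (by simpa using hz.trans ht1)
  have hb0 := stepRadii_bounds hτ0 hτ1 n (insert i A)
  have hRi : stepRadii τ n (insert i A) i = t := by simp [stepRadii, ht]
  have hup : update (stepRadii τ n (insert i A)) i t' = stepRadii τ n A := by
    funext j
    rcases eq_or_ne j i with rfl | hj
    · simp [stepRadii, hi, ht']
    · simp [stepRadii, hj]
  set A' : Finset (Fin N) := Finset.univ.filter fun j => i.succAbove j ∈ A with hA'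
  have hcomp : stepRadii τ n (insert i A) ∘ i.succAbove = stepRadii τ n A' := by
    funext j
    simp [stepRadii, hA', Fin.succAbove_ne]
  have hcont : ∀ ρ : ℝ, 0 < ρ → ρ ≤ t → (∀ x ∈ positions a b u, ‖x‖ ≠ ρ) →
      ContinuousOn (dressed a b w S) (Metric.sphere 0 ρ) := by
    intro ρ h1 h2 h3 z hz
    have hz : ‖z‖ = ρ := by simpa using hz
    refine (hw.dressed_analyticAt hS (hDt z (hz.trans_le h2)) ?_ (fun hzp => h3 z hzp hz)
      (hbel z (hz.trans_le h2))).continuousAt.continuousWithinAt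
    rintro rfl
    rw [norm_zero] at hz
    linarith
  set P : Finset ℂ := (boxes a b u M).filter fun s =>
    t' < ‖s‖ ∧ ‖s‖ < t ∧ IsAddable a b u S s with hPdef
  have hP : ∀ s, s ∈ P ↔ t' < ‖s‖ ∧ ‖s‖ < t ∧ IsAddable a b u S s := by
    intro s
    rw [hPdef, Finset.mem_filter]
    refine ⟨fun hs => hs.2, fun hs => ⟨?_, hs⟩⟩
    exact boxes_mono (by omega) (hs.2.2.mem_boxes hSm)
  obtain ⟨res, g, hres, hg, hfg⟩ := hw.exists_principalParts h hS ht'0 hDt hbel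
    (hτ (n + 1)) (hτ n) P hP
  have hshrink := coreIntegral_shrink (a := a) (b := b) (w := dressed a b w S) (h := g)
    (R := stepRadii τ n (insert i A)) (m := t') (M := t) (r := t') ht'0
    (fun j => (hb0 j).1) (fun j => (hb0 j).2) hat hbt i le_rfl (hb0 i).1
    (fun j => by
      by_cases hj : j ∈ insert i A
      · rw [stepRadii, if_pos hj]; exact hcont _ ht0 le_rfl (hτ n)
      · rw [stepRadii, if_neg hj]; exact hcont _ ht'0 htlt.le (hτ (n + 1)))
    (hcont _ ht'0 htlt.le (hτ (n + 1))) P res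
    (fun s hs => by rw [hRi]; exact ⟨((hP s).1 hs).1, ((hP s).1 hs).2.1⟩)
    (fun z h1 h2 => hg z h1 (by rwa [hRi] at h2))
    (fun z hz => hfg z hz.ge (hz.trans_le htlt.le) fun hzp => hτ _ z hzp hz)
    (fun z hz => by
      rw [hRi] at hz
      exact hfg z (htlt.le.trans hz.ge) hz.le fun hzp => hτ _ z hzp hz)
  rw [hup, hA, hcomp] at hshrink
  rw [hshrink]
  unfold contributionSum
  rw [sum_piFinset_succAbove i, sum_piFinset_succAbove i]
  have hF : ∀ B : Finset (Fin (N + 1)), (∀ j, i.succAbove j ∈ B ↔ i.succAbove j ∈ A) →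
      ((fun j => (boxes a b u M).filter fun x => ‖x‖ < stepRadii τ n B j) ∘ i.succAbove) =
      fun j => (boxes a b u M).filter fun x => ‖x‖ < stepRadii τ n A' j := by
    intro B hB
    funext j
    simp [stepRadii, hA', hB]
  rw [hF A (fun _ => Iff.rfl), hF (insert i A) (fun j => by simp [Fin.succAbove_ne])]
  have hRA : stepRadii τ n A i = t' := by simp [stepRadii, hi, ht']
  simp only [hRi, hRA]
  -- The tuples whose `i`-th entry is a fixed point `x` of the annulus.
  have hterm : ∀ x ∈ boxes a b u M, t' < ‖x‖ → ‖x‖ < t →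
      ∑ p ∈ Fintype.piFinset fun j => (boxes a b u M).filter fun x => ‖x‖ < stepRadii τ n A' j,
        contribution a b (dressed a b w S) (i.insertNth x p : Fin (N + 1) → ℂ) =
      if IsAddable a b u S x then 2 * Real.pi * Complex.I * res x *
        coreIntegral a b (fun z => dressed a b w S z * link a b x z) 0 (stepRadii τ n A')
      else 0 := by
    intro x hx hx1 hx2
    have hp : ∀ p ∈ Fintype.piFinset fun j =>
        (boxes a b u M).filter fun x => ‖x‖ < stepRadii τ n A' j, ∀ j, ‖p j‖ < t := by
      intro p hp j
      rw [Fintype.mem_piFinset] at hp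
      exact (Finset.mem_filter.1 (hp j)).2.trans_le (stepRadii_bounds hτ0 hτ1 n A' j).2
    have hlt : ∀ c : ℂ, ‖c‖ * t < t' → ∀ z : ℂ, ‖z‖ ≤ t → ‖c‖ * ‖z‖ < ‖x‖ := fun c hc z hz =>
      (mul_le_mul_of_nonneg_left hz (norm_nonneg c)).trans_lt (hc.trans hx1)
    have hparr : ∀ p : Fin N → ℂ, (∀ j, ‖p j‖ < t) → ∀ j,
        (i.insertNth x p : Fin (N + 1) → ℂ) i ≠
          a * (i.insertNth x p : Fin (N + 1) → ℂ) (i.succAbove j) ∧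
        (i.insertNth x p : Fin (N + 1) → ℂ) i ≠
          b * (i.insertNth x p : Fin (N + 1) → ℂ) (i.succAbove j) := by
      intro p hp j
      simp only [Fin.insertNth_apply_same, Fin.insertNth_apply_succAbove]
      constructor <;> intro he
      · have := hlt a hat _ (hp j).le
        rw [← norm_mul, ← he] at this
        exact lt_irrefl _ this
      · have := hlt b hbt _ (hp j).le
        rw [← norm_mul, ← he] at this
        exact lt_irrefl _ this
    have hmer : ∀ p : Fin N → ℂ, (∀ j, ‖p j‖ < t) → ∀ j,
        MeromorphicAt (dressed a b w S) ((i.insertNth x p : Fin (N + 1) → ℂ) j) := by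
      intro p hp j
      have : ‖(i.insertNth x p : Fin (N + 1) → ℂ) j‖ ≤ t := by
        refine Fin.succAboveCases i ?_ (fun j => ?_) j
        · simpa using hx2.le
        · simpa using (hp j).le
      exact (hw.dressed_simplePole h hS (hDt _ this) (hbel _ this)).1
    obtain ⟨hr1, hr2⟩ := hres x hx1.le hx2.le
    split_ifs with hadd
    · have hbel' : ∀ z : ℂ, ‖z‖ ≤ t → IsBelow a b (insert x S) z := by
        intro z hz s hs
        rcases Finset.mem_insert.1 hs with rfl | hs
        · exact ⟨hlt a hat z hz, hlt b hbt z hz⟩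
        · exact hbel z hz s hs
      have hins : insert x S ⊆ boxes a b u (m + 1) := by
        intro s hs
        rcases Finset.mem_insert.1 hs with rfl | hs
        · exact hadd.mem_boxes hSm
        · exact boxes_mono (Nat.le_succ m) (hSm hs)
      have hih := ih n (m + 1) (insert x S) A' (hS.insert hadd) hins (by omega) hbel'
      rw [dressed_insert _ _ _ hadd.2.1] at hih
      rw [hih, contributionSum, Finset.mul_sum]
      refine Finset.sum_congr rfl fun p hpm => ?_
      have hpt := hp p hpm
      obtain ⟨c, hc, -⟩ := hw.exists_contribution h N (insert x S) p (hS.insert hadd)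
        (fun j => hDt _ (hpt j).le) fun j => hbel' _ (hpt j).le
      rw [hc.contribution_eq]
      rw [dressed_insert _ _ _ hadd.2.1] at hc
      refine HasCoreContribution.contribution_eq (HasCoreContribution.of_removeNth h.a_lt h.b_lt i
        (hparr p hpt) (hmer p hpt) (by simpa using hr1) ?_)
      have e : (i.insertNth x p : Fin (N + 1) → ℂ) ∘ i.succAbove = p := by
        funext j; simp
      rw [e]
      simpa using hc
    · have hrz : res x = 0 := by
        by_contra hne
        exact hadd (hr2.1 hne)
      rw [hrz] at hr1
      refine Finset.sum_eq_zero fun p hpm => ?_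
      exact HasCoreContribution.contribution_eq (HasCoreContribution.of_residue_zero h.a_lt h.b_lt i
        (hparr p (hp p hpm)) (hmer p (hp p hpm)) (by simpa using hr1))
  have hsplit : (boxes a b u M).filter (fun x => ‖x‖ < t) =
      (boxes a b u M).filter (fun x => ‖x‖ < t') ∪
        (boxes a b u M).filter (fun x => t' < ‖x‖ ∧ ‖x‖ < t) := by
    ext x
    simp only [Finset.mem_filter, Finset.mem_union]
    constructor
    · rintro ⟨h1, h2⟩
      rcases lt_or_gt_of_ne (hτ (n + 1) x (boxes_subset_positions h1)) with h3 | h3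
      · exact Or.inl ⟨h1, h3⟩
      · exact Or.inr ⟨h1, h3, h2⟩
    · rintro (⟨h1, h2⟩ | ⟨h1, h2, h3⟩)
      · exact ⟨h1, h2.trans htlt⟩
      · exact ⟨h1, h3⟩
  rw [hsplit, Finset.sum_union]
  · congr 1
    rw [Finset.sum_congr (s₁ := (boxes a b u M).filter (fun x => t' < ‖x‖ ∧ ‖x‖ < t)) rfl
      fun x hx => by
        have hx := Finset.mem_filter.1 hx
        exact hterm x hx.1 hx.2.1 hx.2.2, ← Finset.sum_filter, Finset.filter_filter]
    refine Finset.sum_congr ?_ fun _ _ => rfl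
    rw [hPdef]
    refine Finset.filter_congr fun x _ => ?_
    tauto
  · rw [Finset.disjoint_left]
    intro x h1 h2
    have h1 := (Finset.mem_filter.1 h1).2
    have h2 := (Finset.mem_filter.1 h2).2.1
    linarith

/-- The integral over tori centred at the origin is the sum of the contributions of the enclosed
tuples of boxes, by induction on the number of variables and by shrinking the torus towards the
origin, where no boxes are left. -/
theorem IsSeeded.coreIntegral_eq_contributionSum (hw : IsSeeded u w D) (h : IsGeneric a b u)
    (hD : Metric.closedBall 0 1 ⊆ D) {τ : ℝ} (hτ0 : 0 < τ) (hτ1 : τ < 1) (haτ : ‖a‖ < τ)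
    (hbτ : ‖b‖ < τ) (hτ : ∀ n : ℕ, ∀ x ∈ positions a b u, ‖x‖ ≠ τ ^ n) (M : ℕ) :
    ∀ (N n m : ℕ) (S : Finset ℂ) (A : Finset (Fin N)), IsDiagram a b u S →
      S ⊆ boxes a b u m → m + N ≤ M → (∀ z : ℂ, ‖z‖ ≤ τ ^ n → IsBelow a b S z) →
      coreIntegral a b (dressed a b w S) 0 (stepRadii τ n A) =
        contributionSum a b u w M S (stepRadii τ n A) := by
  intro N
  induction N with
  | zero =>
    intro n m S A _ _ _ _
    have hc : ∀ p : Fin 0 → ℂ, contribution a b (dressed a b w S) p = 1 := fun p =>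
      HasCoreContribution.contribution_eq
        (Eventually.of_forall fun ε => coreIntegral_fin_zero _ _ _ _ _)
    rw [coreIntegral_fin_zero, contributionSum, Finset.sum_congr rfl fun p _ => hc p]
    simp
  | succ N ih =>
    have hpow : ∀ n, τ ^ (n + 1) ≤ τ ^ n := fun n =>
      pow_le_pow_of_le_one hτ0.le hτ1.le (Nat.le_succ n)
    have key : ∀ n, (∀ (m : ℕ) (S : Finset ℂ), IsDiagram a b u S → S ⊆ boxes a b u m →
        m + (N + 1) ≤ M → (∀ z : ℂ, ‖z‖ ≤ τ ^ (n + 1) → IsBelow a b S z) →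
        coreIntegral a b (dressed a b w S) (0 : Fin (N + 1) → ℂ) (fun _ => τ ^ (n + 1)) =
          contributionSum a b u w M S fun _ : Fin (N + 1) => τ ^ (n + 1)) →
        ∀ (m : ℕ) (S : Finset ℂ) (A : Finset (Fin (N + 1))), IsDiagram a b u S →
        S ⊆ boxes a b u m → m + (N + 1) ≤ M → (∀ z : ℂ, ‖z‖ ≤ τ ^ n → IsBelow a b S z) →
        coreIntegral a b (dressed a b w S) 0 (stepRadii τ n A) =
          contributionSum a b u w M S (stepRadii τ n A) := by
      intro n hn m S A hS hSm hmM hbel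
      induction A using Finset.induction_on with
      | empty =>
        have e : stepRadii τ n (∅ : Finset (Fin (N + 1))) = fun _ => τ ^ (n + 1) := by
          funext j; simp [stepRadii]
        rw [e]
        exact hn m S hS hSm hmM fun z hz => hbel z (hz.trans (hpow n))
      | insert i A hi ihA =>
        exact hw.coreIntegral_insert h hD hτ0 hτ1 haτ hbτ hτ ih hS hSm hmM hbel hi ihA
    obtain ⟨n₀, hn₀⟩ : ∃ n₀ : ℕ, ∀ n ≥ n₀, ∀ x ∈ boxes a b u M, τ ^ n < ‖x‖ := by
      have : ∀ᶠ n : ℕ in atTop, ∀ x ∈ boxes a b u M, τ ^ n < ‖x‖ := by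
        rw [Finset.eventually_all]
        intro x hx
        exact (tendsto_pow_atTop_nhds_zero_of_lt_one hτ0.le hτ1).eventually_lt_const
          (norm_pos_iff.2 (h.positions_ne (boxes_subset_positions hx)))
      exact eventually_atTop.1 this
    have const : ∀ d n, n₀ ≤ n + d → ∀ (m : ℕ) (S : Finset ℂ), IsDiagram a b u S →
        S ⊆ boxes a b u m → m + (N + 1) ≤ M → (∀ z : ℂ, ‖z‖ ≤ τ ^ n → IsBelow a b S z) →
        coreIntegral a b (dressed a b w S) (0 : Fin (N + 1) → ℂ) (fun _ => τ ^ n) =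
          contributionSum a b u w M S fun _ : Fin (N + 1) => τ ^ n := by
      intro d
      induction d with
      | zero =>
        intro n hn m S hS hSm hmM hbel
        rw [hw.coreIntegral_eq_zero_of_lt h hS (pow_pos hτ0 n)
          (fun z hz => hD (by simpa using hz.trans (pow_le_one₀ hτ0.le hτ1.le))) hbel
          (fun q hq => hn₀ n hn q (boxes_mono (by omega) (hq.mem_boxes hSm))) (hτ n)
          (Nat.succ_ne_zero N), contributionSum]
        have hempty : (boxes a b u M).filter (fun x => ‖x‖ < τ ^ n) = ∅ :=
          Finset.filter_eq_empty_iff.2 fun x hx => not_lt.2 (hn₀ n hn x hx).le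
        rw [hempty]
        simp
      | succ d ihd =>
        intro n hn m S hS hSm hmM hbel
        have := key n (ihd (n + 1) (by omega)) m S Finset.univ hS hSm hmM hbel
        have e : stepRadii τ n (Finset.univ : Finset (Fin (N + 1))) = fun _ => τ ^ n := by
          funext j; simp [stepRadii]
        rwa [e] at this
    intro n m S A hS hSm hmM hbel
    exact key n (const n₀ (n + 1) (by omega)) m S A hS hSm hmM hbel

theorem IsSeeded.coreIntegral_unit (hw : IsSeeded u w D) (h : IsGeneric a b u)
    (hD : Metric.closedBall 0 1 ⊆ D) (N : ℕ) :
    coreIntegral a b w (0 : Fin N → ℂ) (fun _ => 1) =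
      ∑ p ∈ Fintype.piFinset fun _ : Fin N => boxes a b u N, contribution a b w p := by
  obtain ⟨τ, hτ0, hτ1, haτ, hbτ, hτ⟩ := h.exists_ratio
  have key := hw.coreIntegral_eq_contributionSum h hD hτ0 hτ1 haτ hbτ hτ N N 0 0 ∅ Finset.univ
    ⟨by simp, by simp⟩ (by simp) (by simp) (by simp [IsBelow])
  have e : stepRadii τ 0 (Finset.univ : Finset (Fin N)) = fun _ => 1 := by
    funext j; simp [stepRadii]
  have e' : dressed a b w ∅ = w := by
    funext z; simp [dressed]
  have e'' : (boxes a b u N).filter (fun x => ‖x‖ < 1) = boxes a b u N :=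
    Finset.filter_true_of_mem fun x hx => h.positions_lt (boxes_subset_positions hx)
  rw [e, e', contributionSum, e', e''] at key
  exact key

end Global

/-! ### Young diagrams -/

section Shapes

variable {k N : ℕ} {a b : ℂ} {u : Fin k → ℂ}

/-- For generic parameters the positions of the boxes already determine all arrows. -/
theorem IsGeneric.hasMultiYoungShape_iff (h : IsGeneric a b u) {lam : Fin k → YoungDiagram}
    {p : Fin N → ℂ} : HasMultiYoungShape a b u lam p ↔
      ∃ e : Fin N ≃ (Σ l : Fin k, (lam l).cells),
        ∀ n, p n = u (e n).1 * a ^ (e n).2.1.2 * b ^ (e n).2.1.1 := by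
  constructor
  · rintro ⟨e, he, -⟩
    exact ⟨e, he⟩
  · rintro ⟨e, he⟩
    refine ⟨e, he, fun l n => ?_, fun m n => ?_, fun m n => ?_⟩
    · rw [SeedArrow, he]
      constructor
      · intro hn
        obtain ⟨h1, h2, h3⟩ := h.inj _ l _ _ 0 0 (by simpa using hn)
        exact ⟨h1, Prod.ext h3 h2⟩
      · rintro ⟨h1, h2⟩
        simp [h1, h2]
    · rw [Arrow, he, he]
      constructor
      · intro hn
        obtain ⟨h1, h2, h3⟩ := h.inj _ (e m).1 _ _ ((e m).2.1.2 + 1) (e m).2.1.1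
          (by rw [hn]; ring)
        exact ⟨h1, Prod.ext h3 h2⟩
      · rintro ⟨h1, h2⟩
        rw [congrArg u h1, h2, right]
        ring
    · rw [Arrow, he, he]
      constructor
      · intro hn
        obtain ⟨h1, h2, h3⟩ := h.inj _ (e m).1 _ _ (e m).2.1.2 ((e m).2.1.1 + 1)
          (by rw [hn]; ring)
        exact ⟨h1, Prod.ext h3 h2⟩
      · rintro ⟨h1, h2⟩
        rw [congrArg u h1, h2, up]
        ring

theorem IsDiagram.mem_of_le {S : Finset ℂ} (hS : IsDiagram a b u S) {l : Fin k}
    {i j i' j' : ℕ} (hi : i' ≤ i) (hj : j' ≤ j) (hmem : u l * a ^ i * b ^ j ∈ S) :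
    u l * a ^ i' * b ^ j' ∈ S := by
  have h1 : u l * a ^ i' * b ^ j ∈ S := by
    induction i, hi using Nat.le_induction with
    | base => exact hmem
    | succ i _ ih =>
      refine ih ((hS.2 _ ⟨l, i, j, rfl⟩).1 ?_)
      convert hmem using 1
      ring
  induction j, hj using Nat.le_induction with
  | base => exact h1
  | succ j _ ih =>
    have h2 : u l * a ^ i' * b ^ j ∈ S := (hS.2 _ ⟨l, i', j, rfl⟩).2 (by convert h1 using 1; ring)
    refine ih ((hS.2 _ ⟨l, i, j, rfl⟩).2 ?_) h2
    convert hmem using 1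
    ring

theorem IsGeneric.mem_boxes_card (h : IsGeneric a b u) {S : Finset ℂ} (hS : IsDiagram a b u S)
    {x : ℂ} (hx : x ∈ S) : x ∈ boxes a b u S.card := by
  obtain ⟨l, i, j, rfl⟩ := hS.1 x hx
  refine mem_boxes.2 ⟨l, i, j, ?_, rfl⟩
  -- The hook of boxes from the seed along row `0` to column `i`, then up to row `j`.
  have := Finset.card_le_card_of_injOn (s := Finset.range (i + j + 1)) (t := S)
    (fun t => u l * a ^ min t i * b ^ (t - i)) (fun t ht => by
      have ht : t < i + j + 1 := by simpa using ht
      exact hS.mem_of_le (min_le_right t i) (by omega) hx) (fun t _ t' _ he => by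
      have := h.inj _ _ _ _ _ _ he
      omega)
  simpa using this

theorem IsGeneric.isDiagram_of_shape (h : IsGeneric a b u) {lam : Fin k → YoungDiagram}
    {p : Fin N → ℂ} (hp : HasMultiYoungShape a b u lam p) :
    Injective p ∧ IsDiagram a b u (Finset.univ.image p) := by
  obtain ⟨e, he⟩ := h.hasMultiYoungShape_iff.1 hp
  have hmem : ∀ (l : Fin k) (i j i' j' : ℕ), i' ≤ i → j' ≤ j →
      u l * a ^ i * b ^ j ∈ Finset.univ.image p → u l * a ^ i' * b ^ j' ∈ Finset.univ.image p := by
    intro l i j i' j' hi hj hn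
    obtain ⟨n, -, hn⟩ := Finset.mem_image.1 hn
    rw [he] at hn
    obtain ⟨rfl, rfl, rfl⟩ := h.inj _ _ _ _ _ _ hn
    have hc : (j', i') ∈ (lam (e n).1).cells := by
      refine (lam (e n).1).isLowerSet (a := (e n).2.1) ?_ (e n).2.2
      exact ⟨hj, hi⟩
    refine Finset.mem_image.2 ⟨e.symm ⟨(e n).1, ⟨(j', i'), hc⟩⟩, Finset.mem_univ _, ?_⟩
    rw [he, Equiv.apply_symm_apply]
  refine ⟨fun m n hmn => ?_, fun s hs => ?_, ?_⟩
  · rw [he, he] at hmn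
    obtain ⟨h1, h2, h3⟩ := h.inj _ _ _ _ _ _ hmn
    refine e.injective ?_
    generalize e m = x at *
    generalize e n = y at *
    obtain ⟨l, ⟨⟨r, c⟩, hx⟩⟩ := x
    obtain ⟨l', ⟨⟨r', c'⟩, hy⟩⟩ := y
    simp only at h1 h2 h3
    subst h1 h2 h3
    rfl
  · obtain ⟨n, -, rfl⟩ := Finset.mem_image.1 hs
    exact ⟨_, _, _, he n⟩
  · rintro x ⟨l, i, j, rfl⟩
    constructor <;> intro hx
    · exact hmem l (i + 1) j i j (Nat.le_succ i) le_rfl (by convert hx using 1; ring)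
    · exact hmem l i (j + 1) i j le_rfl (Nat.le_succ j) (by convert hx using 1; ring)

theorem HasMultiYoungShape.sum_card {lam : Fin k → YoungDiagram} {p : Fin N → ℂ}
    (hp : HasMultiYoungShape a b u lam p) : ∑ l, (lam l).card = N := by
  obtain ⟨e, -⟩ := hp
  have := Fintype.card_congr e
  rw [Fintype.card_fin, Fintype.card_sigma] at this
  rw [this]
  simp [YoungDiagram.card]

theorem IsGeneric.exists_shape (h : IsGeneric a b u) {p : Fin N → ℂ} (hp : Injective p)
    (hS : IsDiagram a b u (Finset.univ.image p)) :
    ∃ lam : Fin k → YoungDiagram, HasMultiYoungShape a b u lam p := by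
  have hinj : ∀ l, Injective fun s : ℕ × ℕ => u l * a ^ s.2 * b ^ s.1 := by
    rintro l ⟨r, c⟩ ⟨r', c'⟩ he
    obtain ⟨-, h1, h2⟩ := h.inj _ _ _ _ _ _ he
    exact Prod.ext h2 h1
  let lam : Fin k → YoungDiagram := fun l =>
    { cells := (Finset.univ.image p).preimage (fun s : ℕ × ℕ => u l * a ^ s.2 * b ^ s.1)
        (hinj l).injOn
      isLowerSet := by
        rintro ⟨r, c⟩ ⟨r', c'⟩ ⟨h1, h2⟩ hs
        simp only [Finset.coe_preimage, mem_preimage, Finset.mem_coe] at hs ⊢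
        exact hS.mem_of_le h2 h1 hs }
  have hlam : ∀ l (s : ℕ × ℕ), s ∈ (lam l).cells ↔
      u l * a ^ s.2 * b ^ s.1 ∈ Finset.univ.image p := fun l s =>
    Finset.mem_preimage (hf := (hinj l).injOn)
  have hpos : ∀ n, ∃ t : Σ l : Fin k, (lam l).cells, p n = u t.1 * a ^ t.2.1.2 * b ^ t.2.1.1 := by
    intro n
    have hn : p n ∈ Finset.univ.image p := Finset.mem_image_of_mem p (Finset.mem_univ n)
    obtain ⟨l, i, j, hx⟩ := hS.1 _ hn
    exact ⟨⟨l, ⟨(j, i), (hlam l _).2 (by rw [← hx]; exact hn)⟩⟩, hx⟩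
  choose f hf using hpos
  refine ⟨lam, h.hasMultiYoungShape_iff.2 ⟨Equiv.ofBijective f ⟨fun m n hmn => hp ?_, ?_⟩, hf⟩⟩
  · rw [hf, hf, hmn]
  · rintro ⟨l, ⟨⟨r, c⟩, hs⟩⟩
    obtain ⟨n, -, hn⟩ := Finset.mem_image.1 ((hlam l _).1 hs)
    refine ⟨n, ?_⟩
    rw [hf] at hn
    obtain ⟨h1, h2, h3⟩ := h.inj _ _ _ _ _ _ hn
    generalize f n = x at *
    obtain ⟨l', ⟨⟨r', c'⟩, hx⟩⟩ := x
    simp only at h1 h2 h3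
    subst h1 h2 h3
    rfl

theorem IsGeneric.exists_tuple (h : IsGeneric a b u) {lam : Fin k → YoungDiagram}
    (hlam : ∑ l, (lam l).card = N) : ∃ p : Fin N → ℂ,
      (∀ i, p i ∈ positions a b u) ∧ HasMultiYoungShape a b u lam p := by
  have hcard : Fintype.card (Σ l : Fin k, (lam l).cells) = N := by
    rw [Fintype.card_sigma, ← hlam]
    simp [YoungDiagram.card]
  let e := (Fintype.equivFinOfCardEq hcard).symm
  exact ⟨fun n => u (e n).1 * a ^ (e n).2.1.2 * b ^ (e n).2.1.1, fun n => ⟨_, _, _, rfl⟩,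
    h.hasMultiYoungShape_iff.2 ⟨e, fun n => rfl⟩⟩

theorem IsGeneric.shape_unique (h : IsGeneric a b u) {lam mu : Fin k → YoungDiagram}
    {p : Fin N → ℂ} (hp : HasMultiYoungShape a b u lam p) (hq : HasMultiYoungShape a b u mu p) :
    lam = mu := by
  have key : ∀ {lam mu : Fin k → YoungDiagram}, HasMultiYoungShape a b u lam p →
      HasMultiYoungShape a b u mu p → ∀ l s, s ∈ (lam l).cells → s ∈ (mu l).cells := by
    rintro lam mu ⟨e, he, -⟩ ⟨e', he', -⟩ l s hs
    have h1 := he (e.symm ⟨l, ⟨s, hs⟩⟩)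
    rw [Equiv.apply_symm_apply, he'] at h1
    generalize e' (e.symm ⟨l, ⟨s, hs⟩⟩) = x at *
    obtain ⟨l', ⟨⟨r', c'⟩, hx⟩⟩ := x
    obtain ⟨r, c⟩ := s
    obtain ⟨h1, h2, h3⟩ := h.inj _ _ _ _ _ _ h1
    simp only at h1 h2 h3
    subst h1 h2 h3
    exact hx
  funext l
  ext s
  exact ⟨key hp hq l s, key hq hp l s⟩

theorem HasMultiYoungShape.exists_perm {lam : Fin k → YoungDiagram} {p q : Fin N → ℂ}
    (hp : HasMultiYoungShape a b u lam p) (hq : HasMultiYoungShape a b u lam q) :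
    ∃ σ : Equiv.Perm (Fin N), q = p ∘ σ := by
  obtain ⟨e, he, -⟩ := hp
  obtain ⟨e', he', -⟩ := hq
  refine ⟨e'.trans e.symm, funext fun n => ?_⟩
  rw [comp_apply, he, he', Equiv.trans_apply, Equiv.apply_symm_apply]

theorem hasYoungShape_iff {v : ℂ} {lam : YoungDiagram} {p : Fin N → ℂ} :
    HasYoungShape a b v lam p ↔
      HasMultiYoungShape a b (fun _ : Fin 1 => v) (fun _ => lam) p := by
  let e₀ : (Σ _ : Fin 1, lam.cells) ≃ lam.cells :=
    ⟨fun x => x.2, fun x => ⟨0, x⟩, fun x => Sigma.ext (Subsingleton.elim _ _) HEq.rfl, fun _ => rfl⟩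
  constructor
  · rintro ⟨e, h1, h2, h3, h4⟩
    refine ⟨e.trans e₀.symm, h1, fun l n => ?_,
      fun m n => ?_, fun m n => ?_⟩
    · rw [h2 n]
      exact ⟨fun h => ⟨Subsingleton.elim _ _, h⟩, fun h => h.2⟩
    · rw [h3 m n]
      exact ⟨fun h => ⟨Subsingleton.elim _ _, h⟩, fun h => h.2⟩
    · rw [h4 m n]
      exact ⟨fun h => ⟨Subsingleton.elim _ _, h⟩, fun h => h.2⟩
  · rintro ⟨e, h1, h2, h3, h4⟩
    refine ⟨e.trans e₀, h1, fun n => ?_,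
      fun m n => ?_, fun m n => ?_⟩
    · exact (h2 0 n).trans ⟨fun h => h.2, fun h => ⟨Subsingleton.elim _ _, h⟩⟩
    · exact (h3 m n).trans ⟨fun h => h.2, fun h => ⟨Subsingleton.elim _ _, h⟩⟩
    · exact (h4 m n).trans ⟨fun h => h.2, fun h => ⟨Subsingleton.elim _ _, h⟩⟩

end Shapes

/-! ### Classification of the contributing pole-tuples -/

theorem prefactor_ne_zero {a b : ℂ} (ha : ‖a‖ < 1) (hb : ‖b‖ < 1) (N : ℕ) :
    prefactor a b N ≠ 0 := by
  have hne : ∀ c : ℂ, ‖c‖ < 1 → 1 - c ≠ 0 := by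
    intro c hc h0
    rw [sub_eq_zero] at h0
    rw [← h0, norm_one] at hc
    exact lt_irrefl _ hc
  have hab : ‖a * b‖ < 1 := by
    rw [norm_mul]
    exact mul_lt_one_of_nonneg_of_lt_one_left (norm_nonneg _) ha hb.le
  unfold prefactor
  have h1 := Complex.two_pi_I_ne_zero
  have h2 := hne a ha
  have h3 := hne b hb
  have h4 := hne _ hab
  have h5 : (N.factorial : ℂ) ≠ 0 := Nat.cast_ne_zero.2 N.factorial_ne_zero
  exact mul_ne_zero (mul_ne_zero (one_div_ne_zero h5)
    (pow_ne_zero _ (div_ne_zero h4 (mul_ne_zero h2 h3)))) (pow_ne_zero _ (one_div_ne_zero h1))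

theorem integrand_torus {a b : ℂ} {w : ℂ → ℂ} {N : ℕ} {p : Fin N → ℂ} {R : Fin N → ℝ}
    (hR : ∀ i, 0 ≤ R i) (hs : Separated a b p R)
    (hw : ∀ i, ContinuousOn w (Metric.sphere (p i) (R i)))
    (h0 : ∀ i, ∀ z ∈ Metric.sphere (p i) (R i), z ≠ 0) :
    TorusIntegrable (integrand a b w N) p R ∧
      (∯ z in T(p, R), integrand a b w N z) = prefactor a b N * coreIntegral a b w p R := by
  have he : ∀ z : Fin N → ℂ, (∀ i, z i ∈ Metric.sphere (p i) (R i)) →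
      prefactor a b N * core a b w z = integrand a b w N z := fun z hz =>
    (integrand_eq_core w fun i => h0 i _ (hz i)).symm
  constructor
  · exact torusIntegrable_congr hR he ((core_torusIntegrable hR hs hw).const_mul _)
  · rw [← torusIntegral_congr hR he, torusIntegral_const_mul]
    rfl

theorem integrand_unit_torus {a b : ℂ} (ha : ‖a‖ < 1) (hb : ‖b‖ < 1) {w : ℂ → ℂ} (N : ℕ)
    (hw : ContinuousOn w (Metric.sphere 0 1)) :
    TorusIntegrable (integrand a b w N) 0 (fun _ => 1) ∧
      contourIntegral a b w N =
        prefactor a b N * coreIntegral a b w (0 : Fin N → ℂ) fun _ => 1 :=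
  integrand_torus (fun _ => zero_le_one)
    (separated_zero (m := 1) (M := 1) (fun _ => le_rfl) (fun _ => le_rfl) (by simpa) (by simpa))
    (fun _ => hw) fun _ z hz => by
      rintro rfl
      simp at hz

theorem HasCoreContribution.hasContribution {a b : ℂ} (ha : ‖a‖ < 1) (hb : ‖b‖ < 1) {w : ℂ → ℂ}
    {N : ℕ} {p : Fin N → ℂ} (hw : ∀ i, MeromorphicAt w (p i)) {c : ℂ}
    (h : HasCoreContribution a b w p c) :
    HasContribution (integrand a b w N) p (prefactor a b N * c) := by
  -- `pairFactor` divides by the variables, so the circles have to avoid the origin.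
  have h0 : ∀ᶠ ε : ℝ in 𝓝[>] 0, ∀ i, ∀ z ∈ Metric.closedBall (p i) ε, z ≠ p i → z ≠ 0 := by
    rw [eventually_all]
    intro i
    refine eventually_closedBall_of_punctured ?_
    by_cases hp : p i = 0
    · rw [hp]; exact self_mem_nhdsWithin
    · exact (isOpen_ne.eventually_mem hp).filter_mono nhdsWithin_le_nhds
  filter_upwards [eventually_separated ha hb p, eventually_continuousOn_sphere hw, h0, h,
    self_mem_nhdsWithin] with ε h1 h2 h3 h4 hε
  have hε : 0 < ε := hε
  have := integrand_torus (fun _ => hε.le) h1 h2 fun i z hz =>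
    h3 i z (Metric.sphere_subset_closedBall hz) (Metric.ne_of_mem_sphere hz hε.ne')
  rw [h4] at this
  exact this

theorem contribution_comp_perm (a b : ℂ) (w : ℂ → ℂ) {N : ℕ} (p : Fin N → ℂ)
    (σ : Equiv.Perm (Fin N)) : contribution a b w (p ∘ σ) = contribution a b w p := by
  unfold contribution coreIntegral
  congr 1
  funext ε
  have := torusIntegral_comp_perm (core a b w) p (fun _ => ε) σ
  simp only [core_comp_perm] at this
  exact this

/-- The residues are those of `core` times the constant in front of the integrand. -/
theorem IsSeeded.polesClassified {k : ℕ} {a b : ℂ} {u : Fin k → ℂ} {w : ℂ → ℂ} {D D' : Set ℂ}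
    (hw : IsSeeded u w D) (h : IsGeneric a b u) (hD : Metric.closedBall 0 1 ⊆ D) (hD' : D' ⊆ D)
    (hball : Metric.ball 0 1 ⊆ D') (N : ℕ) : PolesClassified a b u w D' N := by
  classical
  have hposD : ∀ x ∈ positions a b u, x ∈ D' := fun x hx =>
    hball (by simpa using h.positions_lt hx)
  have hempty : IsDiagram a b u ∅ := ⟨by simp, by simp⟩
  have hdress : dressed a b w ∅ = w := by
    funext z; simp [dressed]
  have hpre := prefactor_ne_zero h.a_lt h.b_lt N
  have hcontr : ∀ p : Fin N → ℂ, (∀ i, p i ∈ D') →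
      HasCoreContribution a b w p (contribution a b w p) ∧
      (contribution a b w p ≠ 0 ↔ Injective p ∧ IsDiagram a b u (Finset.univ.image p)) := by
    intro p hp
    obtain ⟨c, hc, hc0⟩ := hw.exists_contribution h N ∅ p hempty (fun i => hD' (hp i))
      (by simp [IsBelow])
    rw [hdress] at hc
    rw [hc.contribution_eq]
    refine ⟨hc, hc0.trans ?_⟩
    simp
  have hmer : ∀ q ∈ D', MeromorphicAt w q := fun q hq => by
    have := (hw.dressed_simplePole h hempty (hD' hq) (by simp [IsBelow])).1
    rwa [hdress] at this
  have hboxes : ∀ p : Fin N → ℂ, (∀ i, p i ∈ D') → contribution a b w p ≠ 0 →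
      p ∈ Fintype.piFinset fun _ : Fin N => boxes a b u N := by
    intro p hp hne
    obtain ⟨h1, h2⟩ := (hcontr p hp).2.1 hne
    rw [Fintype.mem_piFinset]
    intro i
    have := h.mem_boxes_card h2 (Finset.mem_image_of_mem p (Finset.mem_univ i))
    rwa [Finset.card_image_of_injective _ h1, Finset.card_univ, Fintype.card_fin] at this
  have hsphere : ContinuousOn w (Metric.sphere 0 1) := by
    intro z hz
    have hz1 : ‖z‖ = 1 := by simpa using hz
    refine (hw.regular z (hD (Metric.sphere_subset_closedBall hz)) ?_
      ?_).1.continuousAt.continuousWithinAt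
    · rintro rfl
      simp at hz1
    · rintro l rfl
      exact (h.u_lt l).ne hz1
  have hunit := integrand_unit_torus h.a_lt h.b_lt N hsphere
  refine ⟨fun p => prefactor a b N * contribution a b w p, ?_, ?_, ?_, ?_, ?_, ?_, ?_, hunit.1, ?_⟩
  · intro p hp
    exact (hcontr p hp).1.hasContribution h.a_lt h.b_lt fun i => hmer _ (hp i)
  · intro p _ σ
    simp only [contribution_comp_perm]
  · intro p hp
    rw [mul_ne_zero_iff, (hcontr p hp).2]
    constructor
    · rintro ⟨-, h1, h2⟩
      obtain ⟨lam, hlam⟩ := h.exists_shape h1 h2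
      exact ⟨lam, hlam.sum_card, hlam⟩
    · rintro ⟨lam, -, hlam⟩
      exact ⟨hpre, h.isDiagram_of_shape hlam⟩
  · intro lam hlam
    obtain ⟨p, hp, hp'⟩ := h.exists_tuple hlam
    exact ⟨p, fun i => hposD _ (hp i), hp'⟩
  · intro p lam mu h1 h2
    exact h.shape_unique h1 h2
  · intro p q lam h1 h2
    exact h1.exists_perm h2
  · refine (Finset.finite_toSet (Fintype.piFinset fun _ : Fin N => boxes a b u N)).subset ?_
    rintro p ⟨hp, hne⟩
    exact hboxes p hp (right_ne_zero_of_mul hne)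
  · rw [hunit.2, hw.coreIntegral_unit h hD N, Finset.mul_sum,
      finsum_eq_sum_of_support_subset (s := Fintype.piFinset fun _ : Fin N => boxes a b u N)]
    · refine Finset.sum_congr rfl fun p hp => ?_
      rw [Fintype.mem_piFinset] at hp
      exact (finsum_eq_if.trans (if_pos fun i => hposD _ (boxes_subset_positions (hp i)))).symm
    · intro p hp
      rw [mem_support] at hp
      by_cases hpD : ∀ i, p i ∈ D'
      · rw [finsum_eq_if, if_pos hpD] at hp
        exact hboxes p hpD (right_ne_zero_of_mul hp)
      · rw [finsum_eq_if, if_neg hpD] at hp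
        exact (hp rfl).elim

/-! ### The two kinds of one-variable factors -/

theorem IsGeneric.seed_injective {k : ℕ} {a b : ℂ} {u : Fin k → ℂ} (h : IsGeneric a b u) :
    Injective u := fun l l' he => (h.inj l l' 0 0 0 0 (by simpa using he)).1

theorem IsGeneric.isSeeded_seedFactor {k : ℕ} {a b : ℂ} {u : Fin k → ℂ} (h : IsGeneric a b u) :
    IsSeeded u (seedFactor u) univ := by
  have hreg : ∀ q : ℂ, (∀ l, q ≠ u l) →
      AnalyticAt ℂ (seedFactor u) q ∧ seedFactor u q ≠ 0 := by
    intro q hq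
    have h0 : ∏ l, (q - u l) ≠ 0 := Finset.prod_ne_zero_iff.2 fun l _ => sub_ne_zero.2 (hq l)
    have han : AnalyticAt ℂ (fun z => ∏ l, (z - u l)) q :=
      Finset.analyticAt_fun_prod _ fun l _ => by fun_prop
    exact ⟨analyticAt_const.div han h0, div_ne_zero one_ne_zero h0⟩
  refine ⟨fun q _ _ hq => hreg q hq, fun l _ => ?_, 0, le_rfl, ?_⟩
  · classical
    have h1 := (hasOrder_zero_of_analyticAt (f := fun _ => 1) (q := u l) analyticAt_const
      one_ne_zero).div (HasOrder.prod Finset.univ fun l' _ => hasOrder_sub (u l') (u l))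
    have h2 : ∑ l', (if u l = u l' then (1 : ℤ) else 0) = 1 := by
      simp [h.seed_injective.eq_iff]
    rw [h2] at h1
    exact h1
  · obtain ⟨h1, h2⟩ := hreg 0 fun l => (h.u_ne l).symm
    exact hasOrder_zero_of_analyticAt h1 h2

/-- Away from the origin the factor is `z ^ (k - 1)` divided by `∏ (z - u_l) (1 - ab z / u_l)`.
The poles with `ab z = u_l` are excluded from the domain, and the order at the origin is `k - 1`. -/
theorem IsGeneric.isSeeded_instantonFactor {k : ℕ} (hk : 1 ≤ k) {a b : ℂ} {u : Fin k → ℂ}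
    (h : IsGeneric a b u) :
    IsSeeded u (instantonFactor a b u) {z | ∀ l, 1 - a * b * (z / u l) ≠ 0} := by
  classical
  have hord : ∀ q : ℂ, (∀ l, 1 - a * b * (q / u l) ≠ 0) → HasOrder (instantonFactor a b u) q
      (0 - ((if q = 0 then 1 else 0) +
        ∑ l, ((if q = u l then 1 else 0) - (if q = 0 then 1 else 0) + 0))) := by
    intro q hq
    have h1 : ∀ l, HasOrder (fun z => 1 - u l / z) q
        ((if q = u l then 1 else 0) - (if q = 0 then 1 else 0)) := by
      intro l
      refine ((hasOrder_sub (u l) q).div (hasOrder_sub 0 q)).congr ?_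
      have h0 : ∀ᶠ z in 𝓝[≠] q, z ≠ 0 := by
        by_cases hq0 : q = 0
        · rw [hq0]; exact self_mem_nhdsWithin
        · exact (isOpen_ne.eventually_mem hq0).filter_mono nhdsWithin_le_nhds
      filter_upwards [h0] with z hz
      rw [sub_zero, sub_div, div_self hz]
    have h2 : ∀ l, HasOrder (fun z => 1 - a * b * (z / u l)) q 0 := fun l =>
      hasOrder_zero_of_analyticAt (by
        simp only [div_eq_mul_inv]
        fun_prop) (hq l)
    have h3 := (hasOrder_zero_of_analyticAt (f := fun _ => 1) (q := q) analyticAt_const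
      one_ne_zero).div ((hasOrder_sub 0 q).mul
        (HasOrder.prod Finset.univ fun l _ => (h1 l).mul (h2 l)))
    simpa only [sub_zero] using! h3
  refine ⟨fun q hq h0 hqu => ?_, fun l hl => ?_, k - 1, by omega, ?_⟩
  · have hne : q * ∏ l, ((1 - u l / q) * (1 - a * b * (q / u l))) ≠ 0 := by
      refine mul_ne_zero h0 (Finset.prod_ne_zero_iff.2 fun l _ => mul_ne_zero ?_ (hq l))
      rw [sub_ne_zero, ne_eq, eq_div_iff h0, one_mul]
      exact hqu l
    refine ⟨analyticAt_const.div (analyticAt_id.mul (Finset.analyticAt_fun_prod _ fun l _ => ?_))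
      hne, div_ne_zero one_ne_zero hne⟩
    refine (analyticAt_const.sub (analyticAt_const.div analyticAt_id h0)).mul ?_
    simp only [div_eq_mul_inv]
    fun_prop
  · have := hord (u l) hl
    simpa [h.u_ne l, h.seed_injective.eq_iff] using this
  · have := hord 0 (by simp)
    simp only [(h.u_ne _).symm, if_true, if_false] at this
    convert this using 1
    simp
    ring

theorem isGeneric_of_independent {k : ℕ} {a b : ℂ} {u : Fin k → ℂ} (ha₀ : a ≠ 0) (hb₀ : b ≠ 0)
    (ha : ‖a‖ < 1) (hb : ‖b‖ < 1) (hgen : ∀ i j : ℤ, a ^ i * b ^ j = 1 → i = 0 ∧ j = 0)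
    (hu₀ : ∀ l, u l ≠ 0) (hu : ∀ l, ‖u l‖ < 1)
    (hsep : ∀ (l l' : Fin k) (i j : ℤ), u l = u l' * a ^ i * b ^ j → l = l') :
    IsGeneric a b u := by
  refine ⟨ha₀, hb₀, ha, hb, hu₀, hu, fun l l' i j i' j' he => ?_⟩
  have e1 : u l = u l' * a ^ ((i' : ℤ) - i) * b ^ ((j' : ℤ) - j) := by
    rw [zpow_sub₀ ha₀, zpow_sub₀ hb₀]
    simp only [zpow_natCast]
    have := pow_ne_zero i ha₀
    have := pow_ne_zero j hb₀
    field_simp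
    exact he
  obtain rfl := hsep _ _ _ _ e1
  have e2 : a ^ ((i' : ℤ) - i) * b ^ ((j' : ℤ) - j) = 1 := by
    rw [mul_assoc] at e1
    exact (mul_eq_left₀ (hu₀ l)).1 e1.symm
  have := hgen _ _ e2
  omega

end HallLittlewood

theorem mainTheorem1 (a b : ℂ) (ha₀ : a ≠ 0) (hb₀ : b ≠ 0) (ha : ‖a‖ < 1) (hb : ‖b‖ < 1)
    (hgen : ∀ i j : ℤ, a ^ i * b ^ j = 1 → i = 0 ∧ j = 0) :
    -- the Hall-Littlewood index
    (∀ u : ℂ, u ≠ 0 → ‖u‖ < 1 → ∀ N : ℕ,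
      ∃ res : (Fin N → ℂ) → ℂ,
        -- `res p` is the contribution of the ordered pole-tuple `p`
        (∀ p : Fin N → ℂ, HallLittlewood.HasContribution
          (HallLittlewood.integrand a b (fun z => 1 / (z - u)) N) p (res p)) ∧
        -- it does not depend on the order
        (∀ (p : Fin N → ℂ) (σ : Equiv.Perm (Fin N)), res (p ∘ σ) = res p) ∧
        -- the contributing pole-tuples are exactly those shaped like an `N`-box Young diagram
        (∀ p : Fin N → ℂ, res p ≠ 0 ↔
          ∃ lam : YoungDiagram, lam.card = N ∧ HallLittlewood.HasYoungShape a b u lam p) ∧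
        -- every `N`-box diagram occurs, and pole-tuples correspond to diagrams one-to-one up to reordering
        (∀ lam : YoungDiagram, lam.card = N →
          ∃ p : Fin N → ℂ, HallLittlewood.HasYoungShape a b u lam p) ∧
        (∀ (p : Fin N → ℂ) (lam mu : YoungDiagram), HallLittlewood.HasYoungShape a b u lam p →
          HallLittlewood.HasYoungShape a b u mu p → lam = mu) ∧
        (∀ (p q : Fin N → ℂ) (lam : YoungDiagram), HallLittlewood.HasYoungShape a b u lam p →
          HallLittlewood.HasYoungShape a b u lam q → ∃ σ : Equiv.Perm (Fin N), q = p ∘ σ) ∧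
        -- the index is the sum of the contributions of all ordered pole-tuples
        {p : Fin N → ℂ | res p ≠ 0}.Finite ∧
        TorusIntegrable (HallLittlewood.integrand a b (fun z => 1 / (z - u)) N) 0 (fun _ => 1) ∧
        HallLittlewood.contourIntegral a b (fun z => 1 / (z - u)) N = ∑ᶠ p : Fin N → ℂ, res p ∧
        TorusIntegrable (HallLittlewood.integrand a b (fun z => 1 / z) N) 0 (fun _ => 1) ∧
        HallLittlewood.hallLittlewoodIndex a b N = ∑ᶠ p : Fin N → ℂ, res p) ∧
    -- `k` seeds: pole-tuples of the `U(k)` integrals are `k`-tuples of Young diagrams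
    (∀ (k : ℕ), 1 ≤ k → ∀ u : Fin k → ℂ, (∀ l, u l ≠ 0) → (∀ l, ‖u l‖ < 1) →
      (∀ (l l' : Fin k) (i j : ℤ), u l = u l' * a ^ i * b ^ j → l = l') → ∀ N : ℕ,
        HallLittlewood.PolesClassified a b u (HallLittlewood.seedFactor u) Set.univ N ∧
        ((∀ l, ‖a * b‖ < ‖u l‖) →
          HallLittlewood.PolesClassified a b u (HallLittlewood.instantonFactor a b u)
            (Metric.ball 0 1) N)) := by
  have hsingle : ∀ u : ℂ, HallLittlewood.seedFactor (fun _ : Fin 1 => u) = fun z => 1 / (z - u) := by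
    intro u
    funext z
    simp [HallLittlewood.seedFactor]
  refine ⟨fun u hu₀ hu N => ?_, fun k hk u hu₀ hu hsep N => ?_⟩
  · have h : HallLittlewood.IsGeneric a b (fun _ : Fin 1 => u) :=
      HallLittlewood.isGeneric_of_independent ha₀ hb₀ ha hb hgen (fun _ => hu₀) (fun _ => hu)
        fun _ _ _ _ _ => Subsingleton.elim _ _
    obtain ⟨res, h1, h2, h3, h4, h5, h6, h7, h8, h9⟩ := h.isSeeded_seedFactor.polesClassified h
      (Set.subset_univ _) (Set.subset_univ Set.univ) (Set.subset_univ _) N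
    rw [hsingle] at h1 h8 h9
    have hconst : ∀ lam : Fin 1 → YoungDiagram, lam = fun _ => lam 0 := fun lam =>
      funext fun l => congrArg lam (Subsingleton.elim l 0)
    simp only [Set.mem_univ, implies_true, forall_const, true_and, finsum_true] at h1 h2 h3 h4 h7 h9
    have hindex : ContinuousOn (fun z : ℂ => 1 / z) (Metric.sphere 0 1) :=
      ContinuousOn.div (by fun_prop) (by fun_prop) fun z hz => by
        rintro rfl
        simp at hz
    have hpole : ContinuousOn (fun z : ℂ => 1 / (z - u)) (Metric.sphere 0 1) :=
      ContinuousOn.div (by fun_prop) (by fun_prop) fun z hz => by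
        rw [sub_ne_zero]
        rintro rfl
        have : ‖z‖ = 1 := by simpa using hz
        exact hu.ne this
    have hI := HallLittlewood.integrand_unit_torus ha hb N hindex
    refine ⟨res, h1, h2, fun p => (h3 p).trans ⟨?_, ?_⟩, fun lam hlam => ?_,
      fun p lam mu hl hm => ?_, fun p q lam hp hq => ?_, h7, h8, h9, hI.1, ?_⟩
    · rintro ⟨lam, hc, hp⟩
      rw [hconst lam] at hp
      exact ⟨lam 0, by simpa using hc, HallLittlewood.hasYoungShape_iff.2 hp⟩
    · rintro ⟨lam, hc, hp⟩
      exact ⟨fun _ => lam, by simpa using hc, HallLittlewood.hasYoungShape_iff.1 hp⟩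
    · obtain ⟨p, hp⟩ := h4 (fun _ => lam) (by simpa using hlam)
      exact ⟨p, HallLittlewood.hasYoungShape_iff.2 hp⟩
    · exact congrFun (h5 p _ _ (HallLittlewood.hasYoungShape_iff.1 hl)
        (HallLittlewood.hasYoungShape_iff.1 hm)) 0
    · exact h6 p q _ (HallLittlewood.hasYoungShape_iff.1 hp) (HallLittlewood.hasYoungShape_iff.1 hq)
    · rw [HallLittlewood.hallLittlewoodIndex, hI.2,
        ← HallLittlewood.coreIntegral_shift_pole ha hb hu N,
        ← (HallLittlewood.integrand_unit_torus ha hb N hpole).2, h9]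
  · have h := HallLittlewood.isGeneric_of_independent ha₀ hb₀ ha hb hgen hu₀ hu hsep
    refine ⟨h.isSeeded_seedFactor.polesClassified h (Set.subset_univ _) subset_rfl
      (Set.subset_univ _) N, fun hab => ?_⟩
    have hball : Metric.closedBall (0 : ℂ) 1 ⊆ {z | ∀ l, 1 - a * b * (z / u l) ≠ 0} := by
      intro z hz l h0
      have hz : ‖z‖ ≤ 1 := by simpa using hz
      have hpos : 0 < ‖u l‖ := norm_pos_iff.2 (hu₀ l)
      have h1 : u l = a * b * z := by
        have := hu₀ l
        field_simp at h0
        linear_combination h0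
      have h2 : ‖u l‖ = ‖a * b‖ * ‖z‖ := by rw [h1, norm_mul]
      have := hab l
      nlinarith [norm_nonneg (a * b)]
    exact (h.isSeeded_instantonFactor hk).polesClassified h hball
      (Metric.ball_subset_closedBall.trans hball) subset_rfl N
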